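/- All functions are real and smooth ($C^\infty$). For a function $F=F(x,y)$ let $\Omega_F=\frac{d}{dx}+F(x,y)$, acting along a function $y=y(x)$ by $u\mapsto u_x+F(x,y)\,u$, so that the equation $\Omega_F^2[y]=\Omega_F[\Omega_F[y]]=0$ reads $$y_{xx}+(2F+yF_y)\,y_x+y\,(F^2+F_x)=0 .$$ A point transformation on an open set $V\subseteq\mathbb R^2$ is a smooth map $(x,y)\mapsto(z,w)=(\rho(x,y),\psi(x,y))$ on $V$ with $\rho_x\psi_y-\rho_y\psi_x\neq0$ everywhere on $V$. (a) Let $U\subseteq\mathbb R^2$ be a domain (open and connected) all of whose vertical slices $\{y:(x,y)\in U\}$ are intervals (possibly empty), and let $F$ be smooth on $U$. The following are equivalent: 1. $\Omega_F^2[y]=0$ is linearizable by an invertible point transformation, i.e. every point of $U$ has an open neighbourhood on which an injective point transformation maps the equation to a linear equation $w''+a(z)w'+b(z)w+c(z)=0$ with smooth coefficients; 2. every point of $U$ has an open neighbourhood on which an injective point transformation maps the equation to $w''=0$; 3. $F(x,y)=\alpha(x)\,y+\beta(x)$ on $U$ for some smooth functions $\alpha,\beta$ of $x$; 4. an injective point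 transformation on $U$ maps the equation to an equation $\Omega_G^2[w]=0$ with $G(z,w)=\tilde\alpha(z)\,w$ for some smooth function $\tilde\alpha$. (b) Let $F(x,y)=\alpha(x)\,y$ with $\alpha$ smooth on an open set $S\subseteq\mathbb R$, and let $k_1,\dots,k_6$ be real constants with $k_3k_6\neq0$, $k_5\neq1$, $k_5\notin S$. Let $T$ and $J$ be any antiderivatives on $S$, $T(x)=\int\frac{(k_5-x)\alpha(x)}{k_3}\,dx$ and $J(x)=\int\frac{k_6(k_1-T(x))}{(k_5-x)^2}\,dx$. Then $$\rho(x,y)=\frac{x-k_5}{k_3y}-k_1+T(x),$$ $$\begin{aligned}\psi(x,y)=\frac{1}{(k_5-1)k_3(k_5-x)y}\Big[&\big((k_5-1)k_4(k_5-x)+k_6(x-1)\big)(x-k_5)\\&-k_3\big((k_5-1)(k_4k_1-k_2)(k_5-x)+k_6k_1(x-1)\big)y\\&+k_3y\Big(\big((k_5-1)k_4(k_5-x)+k_6(x-1)\big)T(x)+(k_5-1)(k_5-x)J(x)\Big)\Big]\end{aligned}$$ define a point transformation on $\{(x,y):x\in S,\ y\neq0\}$ that maps $\Omega_F^2[y]=0$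 to $w''=0$. -/

import Mathlib

open scoped ContDiff Topology

/-- The operator `d/dx + F(x, y)` along a fixed function `y = y(x)`, acting on functions `u`. -/
noncomputable def chainOp (F : ℝ × ℝ → ℝ) (y u : ℝ → ℝ) : ℝ → ℝ :=
  fun x => deriv u x + F (x, y x) * u x

/-- `Ω_F^n[y]`, the `n`-fold iterate of `d/dx + F(x, y)` applied to `y`. -/
noncomputable def chainIter (F : ℝ × ℝ → ℝ) (n : ℕ) (y : ℝ → ℝ) : ℝ → ℝ :=
  (chainOp F y)^[n] y

/-- A scalar ordinary differential equation, given by the relation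
"the function `y` satisfies the equation at the point `x`". -/
abbrev ScalarODE := (ℝ → ℝ) → ℝ → Prop

/-- The second order chain equation `Ω_F^2[y] = 0`. -/
def chainEq (F : ℝ × ℝ → ℝ) : ScalarODE :=
  fun y x => chainIter F 2 y x = 0

/-- The second order linear equation `w'' + a(z) w' + b(z) w + c(z) = 0`. -/
def linearEq (a b c : ℝ → ℝ) : ScalarODE :=
  fun w z => deriv (deriv w) z + a z * deriv w z + b z * w z + c z = 0

/-- The trivial equation `w'' = 0`. -/
def trivialEq : ScalarODE :=
  fun w z => deriv (deriv w) z = 0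

/-- The Jacobian `ρ_x ψ_y - ρ_y ψ_x` of a map `Φ = (ρ, ψ)` of the plane. -/
noncomputable def planeJacobian (Φ : ℝ × ℝ → ℝ × ℝ) (p : ℝ × ℝ) : ℝ :=
  (fderiv ℝ Φ p (1, 0)).1 * (fderiv ℝ Φ p (0, 1)).2
    - (fderiv ℝ Φ p (0, 1)).1 * (fderiv ℝ Φ p (1, 0)).2

/-- `(z, w) = Φ(x, y)` is a (locally invertible, smooth) point transformation on the open
set `V`. -/
structure IsPointTransformation (Φ : ℝ × ℝ → ℝ × ℝ) (V : Set (ℝ × ℝ)) : Prop where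
  isOpen : IsOpen V
  smooth : ContDiffOn ℝ ∞ Φ V
  jacobian_ne_zero : ∀ p ∈ V, planeJacobian Φ p ≠ 0

/-- The change of variables `(z, w) = Φ(x, y)` on `V` maps the second order equation `E₁` for
`y(x)` to the second order equation `E₂` for `w(z)`: whenever `Φ` carries the graph of `y` near
`(x, y x)` into the graph of `w`, the function `y` satisfies `E₁` at `x` if and only if `w`
satisfies `E₂` at the corresponding point `z`. -/
def MapsEquation (Φ : ℝ × ℝ → ℝ × ℝ) (V : Set (ℝ × ℝ)) (E₁ E₂ : ScalarODE) : Prop :=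
  ∀ (y w : ℝ → ℝ) (x : ℝ), (x, y x) ∈ V →
    ContDiffAt ℝ 2 y x → ContDiffAt ℝ 2 w (Φ (x, y x)).1 →
    (∀ᶠ s in 𝓝 x, w (Φ (s, y s)).1 = (Φ (s, y s)).2) →
    (E₁ y x ↔ E₂ w (Φ (x, y x)).1)

/-- On `U`, the equation `E` is linearizable by invertible point transformations: around every
point of `U` some invertible point transformation maps it to a linear equation with smooth
coefficients. -/
def Linearizable (U : Set (ℝ × ℝ)) (E : ScalarODE) : Prop :=
  ∀ p ∈ U, ∃ (V : Set (ℝ × ℝ)) (Φ : ℝ × ℝ → ℝ × ℝ) (a b c : ℝ → ℝ),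
    p ∈ V ∧ V ⊆ U ∧ IsPointTransformation Φ V ∧ Set.InjOn Φ V ∧
    ContDiffOn ℝ ∞ a ((fun q => (Φ q).1) '' V) ∧
    ContDiffOn ℝ ∞ b ((fun q => (Φ q).1) '' V) ∧
    ContDiffOn ℝ ∞ c ((fun q => (Φ q).1) '' V) ∧
    MapsEquation Φ V E (linearEq a b c)

/-- Around every point of `U`, some invertible point transformation maps `E` to `w'' = 0`. -/
def Trivializable (U : Set (ℝ × ℝ)) (E : ScalarODE) : Prop :=
  ∀ p ∈ U, ∃ (V : Set (ℝ × ℝ)) (Φ : ℝ × ℝ → ℝ × ℝ),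
    p ∈ V ∧ V ⊆ U ∧ IsPointTransformation Φ V ∧ Set.InjOn Φ V ∧
    MapsEquation Φ V E trivialEq

/-- The first component `ρ` of the linearizing family; `T` stands for
`∫ (k₅ - s) α(s) / k₃ ds`. -/
noncomputable def rhoFam (k₁ k₃ k₅ : ℝ) (T : ℝ → ℝ) (x y : ℝ) : ℝ :=
  (x - k₅) / (k₃ * y) - k₁ + T x

/-- The second component `ψ` of the linearizing family; `J` stands for
`∫ k₆ (k₁ - T(x)) / (k₅ - x)² dx`. -/
noncomputable def psiFam (k₁ k₂ k₃ k₄ k₅ k₆ : ℝ) (T J : ℝ → ℝ) (x y : ℝ) : ℝ :=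
  ((k₅ - 1) * k₃ * (k₅ - x) * y)⁻¹ *
    (((k₅ - 1) * k₄ * (k₅ - x) + k₆ * (x - 1)) * (x - k₅)
      - k₃ * ((k₅ - 1) * (k₄ * k₁ - k₂) * (k₅ - x) + k₆ * k₁ * (x - 1)) * y
      + k₃ * y * (((k₅ - 1) * k₄ * (k₅ - x) + k₆ * (x - 1)) * T x
        + (k₅ - 1) * (k₅ - x) * J x))

/-!
Every equation in sight is, as far as graphs through an open set are concerned, of the form
`y'' + A₁(x, y) y' + A₀(x, y) = 0` (`HasNormalForm`). A point transformation maps one such equation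
to another if and only if a polynomial identity in velocities and accelerations of parametrized
curves holds (`TransformsJets`, `TransformsJets.mapsEquation`, `MapsEquation.transformsJets`). Being
independent of the parametrization, this identity also controls curves whose image is vertical, and
so it can be composed (`TransformsJets.mapsEquation_comp`), although the intermediate curve need not
be a graph.

*Linearizable implies `F` affine in `y`.* If `(ρ, ψ)` maps `y'' + A₁ y' + A₀ = 0` to a linear
equation, the coefficients of the jet identity express the second derivatives of `ρ` and `ψ` by
their first derivatives and two functions `η`, `θ`. Equality of mixed third derivatives is a Riccati
system for `η` and `θ` (`TransformsJets.exists_riccati`), and equality of the mixed second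
derivatives of `η` and `θ` gives Lie's conditions `A₁_yy = 0` and
`A₀_yy = 2/3 (A₁_xy + A₁ A₁_y)` (`TransformsJets.lie_conditions`). For the chain equation
`A₁ = 2 F + y F_y`, `A₀ = y (F² + F_x)`, and these conditions force `F_yy = 0`
(`partialY_partialY_eq_zero_of_linearEq`). As vertical slices are intervals, `F = α(x) y + β(x)`
globally.

*Affine implies trivializable.* With `B' = β`, the map `(x, y) ↦ (x, exp (B x) y)` removes `β` on
all of `U` (`exists_mapsEquation_linear_coefficient`). The solutions of the chain equation with
`G = α(z) w` form a linear system of curves `c₁ w + c₂ (w A - 1) + c₃ (w B - z) = 0`, where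
`A' = α` and `B' = z α`, so that quotients of `w`, `w A - 1`, `w B - z` are coordinates in which
solutions are straight lines (`exists_transformsJets_trivial`).

The family `(rhoFam, psiFam)` satisfies `ψ = L(x) ρ + J(x) + k₂`, hence `dψ = L dρ + M dx`. The
criterion `transformsJets_of_slope` for such pairs reduces the claim to identities between rational
functions, and serves for the previous local coordinates as well.
-/

/-! ### Partial derivatives of functions of two variables -/

/-- The function `f` is differentiable at `p`, with partial derivatives `a = f_x(p)` and
`b = f_y(p)`. -/
def HasPartials (f : ℝ × ℝ → ℝ) (a b : ℝ) (p : ℝ × ℝ) : Prop :=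
  HasFDerivAt f (a • ContinuousLinearMap.fst ℝ ℝ ℝ + b • ContinuousLinearMap.snd ℝ ℝ ℝ) p

/-- The partial derivative `f_x`. -/
noncomputable def partialX (f : ℝ × ℝ → ℝ) (p : ℝ × ℝ) : ℝ := fderiv ℝ f p (1, 0)

/-- The partial derivative `f_y`. -/
noncomputable def partialY (f : ℝ × ℝ → ℝ) (p : ℝ × ℝ) : ℝ := fderiv ℝ f p (0, 1)

theorem DifferentiableAt.hasPartials {f : ℝ × ℝ → ℝ} {p : ℝ × ℝ} (h : DifferentiableAt ℝ f p) :
    HasPartials f (partialX f p) (partialY f p) p := by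
  have : fderiv ℝ f p = partialX f p • ContinuousLinearMap.fst ℝ ℝ ℝ
      + partialY f p • ContinuousLinearMap.snd ℝ ℝ ℝ := by
    ext <;> simp [partialX, partialY]
  unfold HasPartials
  rw [← this]
  exact h.hasFDerivAt

namespace HasPartials

variable {f g : ℝ × ℝ → ℝ} {a b a' b' : ℝ} {p : ℝ × ℝ}

theorem congr_partials (h : HasPartials f a b p) (ha : a = a') (hb : b = b') :
    HasPartials f a' b' p := ha ▸ hb ▸ h

theorem congr_of_eventuallyEq (h : HasPartials f a b p) (hfg : g =ᶠ[𝓝 p] f) :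
    HasPartials g a b p :=
  HasFDerivAt.congr_of_eventuallyEq h hfg

theorem partialX_eq (h : HasPartials f a b p) : partialX f p = a := by
  have h' : HasFDerivAt f _ p := h
  simp [partialX, h'.fderiv]

theorem partialY_eq (h : HasPartials f a b p) : partialY f p = b := by
  have h' : HasFDerivAt f _ p := h
  simp [partialY, h'.fderiv]

theorem unique (h : HasPartials f a b p) (h' : HasPartials f a' b' p) : a = a' ∧ b = b' :=
  ⟨h.partialX_eq.symm.trans h'.partialX_eq, h.partialY_eq.symm.trans h'.partialY_eq⟩

theorem add (hf : HasPartials f a b p) (hg : HasPartials g a' b' p) :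
    HasPartials (fun q => f q + g q) (a + a') (b + b') p := by
  refine (HasFDerivAt.add hf hg).congr_fderiv ?_
  ext <;> simp

theorem sub (hf : HasPartials f a b p) (hg : HasPartials g a' b' p) :
    HasPartials (fun q => f q - g q) (a - a') (b - b') p := by
  refine (HasFDerivAt.sub hf hg).congr_fderiv ?_
  ext <;> simp

theorem mul (hf : HasPartials f a b p) (hg : HasPartials g a' b' p) :
    HasPartials (fun q => f q * g q) (a * g p + f p * a') (b * g p + f p * b') p := by
  refine (HasFDerivAt.mul hf hg).congr_fderiv ?_
  ext <;> simp <;> ring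

theorem const (c : ℝ) : HasPartials (fun _ => c) 0 0 p := by
  refine (hasFDerivAt_const c p).congr_fderiv ?_
  ext <;> simp

theorem fst : HasPartials (fun q => q.1) 1 0 p := by
  refine hasFDerivAt_fst.congr_fderiv ?_
  ext <;> simp

theorem snd : HasPartials (fun q => q.2) 0 1 p := by
  refine hasFDerivAt_snd.congr_fderiv ?_
  ext <;> simp

theorem comp {h : ℝ → ℝ} {h' : ℝ} (hh : HasDerivAt h h' (f p)) (hf : HasPartials f a b p) :
    HasPartials (fun q => h (f q)) (h' * a) (h' * b) p := by
  refine (HasDerivAt.comp_hasFDerivAt p hh hf).congr_fderiv ?_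
  ext <;> simp

theorem inv (hf : HasPartials f a b p) (h0 : f p ≠ 0) :
    HasPartials (fun q => (f q)⁻¹) (-a / f p ^ 2) (-b / f p ^ 2) p :=
  (hf.comp (hasDerivAt_inv h0)).congr_partials (by ring) (by ring)

theorem hasDerivAt_comp {r t : ℝ → ℝ} {r' t' s : ℝ} (hf : HasPartials f a b (r s, t s))
    (hr : HasDerivAt r r' s) (ht : HasDerivAt t t' s) :
    HasDerivAt (fun s => f (r s, t s)) (a * r' + b * t') s := by
  have := HasFDerivAt.comp_hasDerivAt (f := fun s => (r s, t s)) s hf (hr.prodMk ht)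
  simpa [Function.comp_def] using this

end HasPartials

section Smooth

variable {f : ℝ × ℝ → ℝ} {V : Set (ℝ × ℝ)} {p : ℝ × ℝ}

theorem ContDiffOn.hasPartials (hf : ContDiffOn ℝ ∞ f V) (hV : IsOpen V) (hp : p ∈ V) :
    HasPartials f (partialX f p) (partialY f p) p :=
  ((hf.contDiffAt (hV.mem_nhds hp)).differentiableAt (by simp)).hasPartials

theorem ContDiffOn.partialX (hf : ContDiffOn ℝ ∞ f V) (hV : IsOpen V) :
    ContDiffOn ℝ ∞ (partialX f) V :=
  (hf.fderiv_of_isOpen hV (by simp)).clm_apply contDiffOn_const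

theorem ContDiffOn.partialY (hf : ContDiffOn ℝ ∞ f V) (hV : IsOpen V) :
    ContDiffOn ℝ ∞ (partialY f) V :=
  (hf.fderiv_of_isOpen hV (by simp)).clm_apply contDiffOn_const

theorem ContDiffOn.partialX_partialY (hf : ContDiffOn ℝ ∞ f V) (hV : IsOpen V) (hp : p ∈ V) :
    _root_.partialX (_root_.partialY f) p = _root_.partialY (_root_.partialX f) p := by
  have hc := hf.contDiffAt (hV.mem_nhds hp)
  have hs : IsSymmSndFDerivAt ℝ f p := hc.isSymmSndFDerivAt (by simpa using ENat.LEInfty.out)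
  have hd : DifferentiableAt ℝ (fderiv ℝ f) p :=
    (hc.fderiv_right (m := 1)
      (by rw [one_add_one_eq_two]; exact ENat.LEInfty.out)).differentiableAt (by simp)
  have key : ∀ v w : ℝ × ℝ, fderiv ℝ (fun q => fderiv ℝ f q v) p w
      = fderiv ℝ (fderiv ℝ f) p w v := by
    intro v w
    have := hd.hasFDerivAt.clm_apply (hasFDerivAt_const v p)
    rw [this.fderiv]; simp
  unfold _root_.partialX _root_.partialY
  rw [key, key]
  exact hs.eq _ _

theorem ContDiffOn.hasPartials_partialX (hf : ContDiffOn ℝ ∞ f V) (hV : IsOpen V) (hp : p ∈ V) :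
    HasPartials (_root_.partialX f) (_root_.partialX (_root_.partialX f) p)
      (_root_.partialX (_root_.partialY f) p) p :=
  ((hf.partialX hV).hasPartials hV hp).congr_partials rfl (hf.partialX_partialY hV hp).symm

theorem ContDiffOn.hasPartials_partialY (hf : ContDiffOn ℝ ∞ f V) (hV : IsOpen V) (hp : p ∈ V) :
    HasPartials (_root_.partialY f) (_root_.partialX (_root_.partialY f) p)
      (_root_.partialY (_root_.partialY f) p) p :=
  (hf.partialY hV).hasPartials hV hp

/-- Partial derivatives up to order two, read off from closed expressions for them. -/
theorem partials_eq_of_hasPartials {f₁ f₂ f₁₁ f₁₂ f₂₁ f₂₂ : ℝ × ℝ → ℝ} (hV : IsOpen V)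
    (h : ∀ q ∈ V, HasPartials f (f₁ q) (f₂ q) q) (h₁ : HasPartials f₁ (f₁₁ p) (f₂₁ p) p)
    (h₂ : HasPartials f₂ (f₁₂ p) (f₂₂ p) p) (hp : p ∈ V) :
    partialX f p = f₁ p ∧ partialY f p = f₂ p ∧ partialX (partialX f) p = f₁₁ p ∧
      partialX (partialY f) p = f₁₂ p ∧ partialY (partialY f) p = f₂₂ p := by
  have e₁ : partialX f =ᶠ[𝓝 p] f₁ :=
    Filter.eventuallyEq_of_mem (hV.mem_nhds hp) fun q hq => (h q hq).partialX_eq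
  have e₂ : partialY f =ᶠ[𝓝 p] f₂ :=
    Filter.eventuallyEq_of_mem (hV.mem_nhds hp) fun q hq => (h q hq).partialY_eq
  exact ⟨e₁.eq_of_nhds, e₂.eq_of_nhds, (h₁.congr_of_eventuallyEq e₁).partialX_eq,
    (h₂.congr_of_eventuallyEq e₂).partialX_eq, (h₂.congr_of_eventuallyEq e₂).partialY_eq⟩

end Smooth

/-! ### Two-jets along curves -/

theorem ContDiffAt.hasDerivAt_of_two {y : ℝ → ℝ} {x : ℝ} (hy : ContDiffAt ℝ 2 y x) :
    HasDerivAt y (deriv y x) x :=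
  (hy.differentiableAt (by simp)).hasDerivAt

theorem ContDiffAt.eventually_hasDerivAt {y : ℝ → ℝ} {x : ℝ} (hy : ContDiffAt ℝ 2 y x) :
    ∀ᶠ s in 𝓝 x, HasDerivAt y (deriv y s) s := by
  filter_upwards [hy.eventually (by simp)] with s hs
  exact hs.hasDerivAt_of_two

theorem ContDiffAt.hasDerivAt_deriv {y : ℝ → ℝ} {x : ℝ} (hy : ContDiffAt ℝ 2 y x) :
    HasDerivAt (deriv y) (deriv (deriv y) x) x := by
  have h : ContDiffAt ℝ 1 (fderiv ℝ y) x := hy.fderiv_right (by norm_num)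
  have : ContDiffAt ℝ 1 (deriv y) x := by
    have := h.clm_apply (contDiffAt_const (c := (1 : ℝ)))
    exact this
  exact (this.differentiableAt (by simp)).hasDerivAt

/-- Second derivative of `g ∘ r` in terms of the two-jets of `g` and `r`. -/
theorem deriv_deriv_comp {g r : ℝ → ℝ} {x : ℝ} (hr : ContDiffAt ℝ 2 r x)
    (hg : ContDiffAt ℝ 2 g (r x)) :
    deriv (fun s => g (r s)) x = deriv g (r x) * deriv r x ∧
      deriv (deriv (fun s => g (r s))) x
        = deriv (deriv g) (r x) * deriv r x ^ 2 + deriv g (r x) * deriv (deriv r) x := by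
  have e : deriv (fun s => g (r s)) =ᶠ[𝓝 x] fun s => deriv g (r s) * deriv r s := by
    filter_upwards [hr.eventually_hasDerivAt,
      hr.continuousAt.eventually hg.eventually_hasDerivAt] with s h₁ h₂
    exact (h₂.comp s h₁).deriv
  refine ⟨e.eq_of_nhds, ?_⟩
  rw [e.deriv_eq]
  have := (hg.hasDerivAt_deriv.comp x hr.hasDerivAt_of_two).mul hr.hasDerivAt_deriv
  rw [show (fun s => deriv g (r s) * deriv r s) = (deriv g ∘ r) * deriv r from rfl, this.deriv]
  simp only [Function.comp]
  ring

/-- The derivative of `f` along a curve with velocity `(u, v)`. -/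
noncomputable def curveDeriv (f : ℝ × ℝ → ℝ) (p : ℝ × ℝ) (u v : ℝ) : ℝ :=
  partialX f p * u + partialY f p * v

/-- The second derivative of `f` along a curve with velocity `(u, v)` and acceleration
`(u₂, v₂)`. -/
noncomputable def curveDeriv₂ (f : ℝ × ℝ → ℝ) (p : ℝ × ℝ) (u v u₂ v₂ : ℝ) : ℝ :=
  partialX (partialX f) p * u ^ 2 + 2 * partialX (partialY f) p * u * v
    + partialY (partialY f) p * v ^ 2 + partialX f p * u₂ + partialY f p * v₂

theorem deriv_deriv_along_curve {f : ℝ × ℝ → ℝ} {V : Set (ℝ × ℝ)} {r t : ℝ → ℝ} {x : ℝ}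
    (hV : IsOpen V) (hf : ContDiffOn ℝ ∞ f V) (hp : (r x, t x) ∈ V)
    (hr : ContDiffAt ℝ 2 r x) (ht : ContDiffAt ℝ 2 t x) :
    ContDiffAt ℝ 2 (fun s => f (r s, t s)) x ∧
    deriv (fun s => f (r s, t s)) x = curveDeriv f (r x, t x) (deriv r x) (deriv t x) ∧
      deriv (deriv (fun s => f (r s, t s))) x = curveDeriv₂ f (r x, t x) (deriv r x) (deriv t x)
        (deriv (deriv r) x) (deriv (deriv t) x) := by
  have hc : ContDiffAt ℝ 2 (fun s => (r s, t s)) x := hr.prodMk ht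
  have e : deriv (fun s => f (r s, t s)) =ᶠ[𝓝 x]
      fun s => partialX f (r s, t s) * deriv r s + partialY f (r s, t s) * deriv t s := by
    filter_upwards [hr.eventually_hasDerivAt, ht.eventually_hasDerivAt,
      hc.continuousAt.eventually (hV.mem_nhds hp)] with s h₁ h₂ h₃
    exact ((hf.hasPartials hV h₃).hasDerivAt_comp h₁ h₂).deriv
  refine ⟨?_, e.eq_of_nhds, ?_⟩
  · exact ContDiffAt.comp (g := f) x
      ((hf.contDiffAt (hV.mem_nhds hp)).of_le ENat.LEInfty.out) hc
  rw [e.deriv_eq]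
  have hr' := hr.hasDerivAt_of_two
  have ht' := ht.hasDerivAt_of_two
  have := (((hf.hasPartials_partialX hV hp).hasDerivAt_comp hr' ht').mul hr.hasDerivAt_deriv).add
    (((hf.hasPartials_partialY hV hp).hasDerivAt_comp hr' ht').mul ht.hasDerivAt_deriv)
  refine this.deriv.trans ?_
  unfold curveDeriv₂
  ring

/-! ### Transformation of second order equations at the level of jets -/

/-- The functions satisfying `E` are those satisfying `y'' + A₁(x, y) y' + A₀(x, y) = 0`, as far as
the part of their graphs in `V` is concerned. -/
def HasNormalForm (E : ScalarODE) (A₁ A₀ : ℝ × ℝ → ℝ) (V : Set (ℝ × ℝ)) : Prop :=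
  ∀ (y : ℝ → ℝ) (x : ℝ), (x, y x) ∈ V → ContDiffAt ℝ 2 y x →
    (E y x ↔ deriv (deriv y) x + A₁ (x, y x) * deriv y x + A₀ (x, y x) = 0)

/-- The polynomial identity in velocities `(u, v)` and accelerations `(u₂, v₂)` of parametrized
curves in `V` that expresses, independently of the parametrization, that `Φ` carries
`y'' + A₁ y' + A₀ = 0` to `w'' + a w' + b = 0`. Curves with a vertical tangent, before or after the
transformation, are included. -/
def TransformsJets (Φ : ℝ × ℝ → ℝ × ℝ) (V : Set (ℝ × ℝ)) (A₁ A₀ a b : ℝ × ℝ → ℝ) : Prop :=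
  ∀ p ∈ V, ∀ u v u₂ v₂ : ℝ,
    curveDeriv₂ (fun q => (Φ q).2) p u v u₂ v₂ * curveDeriv (fun q => (Φ q).1) p u v
      - curveDeriv (fun q => (Φ q).2) p u v * curveDeriv₂ (fun q => (Φ q).1) p u v u₂ v₂
      + a (Φ p) * curveDeriv (fun q => (Φ q).2) p u v * curveDeriv (fun q => (Φ q).1) p u v ^ 2
      + b (Φ p) * curveDeriv (fun q => (Φ q).1) p u v ^ 3
    = planeJacobian Φ p * (v₂ * u - v * u₂ + A₁ p * u ^ 2 * v + A₀ p * u ^ 3)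

theorem planeJacobian_eq {Φ : ℝ × ℝ → ℝ × ℝ} {p : ℝ × ℝ} (h : DifferentiableAt ℝ Φ p) :
    planeJacobian Φ p = partialX (fun q => (Φ q).1) p * partialY (fun q => (Φ q).2) p
      - partialY (fun q => (Φ q).1) p * partialX (fun q => (Φ q).2) p := by
  have h₁ := (h.hasFDerivAt.fst).fderiv
  have h₂ := (h.hasFDerivAt.snd).fderiv
  simp [planeJacobian, partialX, partialY, h₁, h₂]

namespace IsPointTransformation

variable {Φ : ℝ × ℝ → ℝ × ℝ} {V : Set (ℝ × ℝ)} {p : ℝ × ℝ}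

theorem smooth_fst (h : IsPointTransformation Φ V) : ContDiffOn ℝ ∞ (fun q => (Φ q).1) V :=
  contDiff_fst.comp_contDiffOn h.smooth

theorem smooth_snd (h : IsPointTransformation Φ V) : ContDiffOn ℝ ∞ (fun q => (Φ q).2) V :=
  contDiff_snd.comp_contDiffOn h.smooth

theorem differentiableAt (h : IsPointTransformation Φ V) (hp : p ∈ V) :
    DifferentiableAt ℝ Φ p :=
  (h.smooth.contDiffAt (h.isOpen.mem_nhds hp)).differentiableAt (by simp)

theorem mono {W : Set (ℝ × ℝ)} (h : IsPointTransformation Φ V) (hW : IsOpen W) (hWV : W ⊆ V) :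
    IsPointTransformation Φ W :=
  ⟨hW, h.smooth.mono hWV, fun q hq => h.jacobian_ne_zero q (hWV hq)⟩

theorem jacobian_partials_ne_zero (h : IsPointTransformation Φ V) (hp : p ∈ V) :
    partialX (fun q => (Φ q).1) p * partialY (fun q => (Φ q).2) p
      - partialY (fun q => (Φ q).1) p * partialX (fun q => (Φ q).2) p ≠ 0 :=
  planeJacobian_eq (h.differentiableAt hp) ▸ h.jacobian_ne_zero p hp

/-- The differential of a point transformation is injective. -/
theorem eq_zero_of_curveDeriv (h : IsPointTransformation Φ V) (hp : p ∈ V) {u v : ℝ}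
    (h₁ : curveDeriv (fun q => (Φ q).1) p u v = 0)
    (h₂ : curveDeriv (fun q => (Φ q).2) p u v = 0) : u = 0 ∧ v = 0 := by
  have hJ := h.jacobian_partials_ne_zero hp
  unfold curveDeriv at h₁ h₂
  constructor
  · refine (mul_eq_zero.1 (?_ : _ * u = 0)).resolve_left hJ
    linear_combination partialY (fun q => (Φ q).2) p * h₁ - partialY (fun q => (Φ q).1) p * h₂
  · refine (mul_eq_zero.1 (?_ : _ * v = 0)).resolve_left hJ
    linear_combination partialX (fun q => (Φ q).1) p * h₂ - partialX (fun q => (Φ q).2) p * h₁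

/-- The differential of a point transformation as an invertible linear map. -/
theorem exists_equiv (h : IsPointTransformation Φ V) (hp : p ∈ V) :
    ∃ L : (ℝ × ℝ) ≃L[ℝ] (ℝ × ℝ), HasFDerivAt Φ (L : (ℝ × ℝ) →L[ℝ] (ℝ × ℝ)) p := by
  have hd := h.differentiableAt hp
  have hinj : Function.Injective (fderiv ℝ Φ p : ℝ × ℝ →ₗ[ℝ] ℝ × ℝ) := by
    rw [injective_iff_map_eq_zero]
    rintro ⟨u, v⟩ huv
    have e : fderiv ℝ Φ p (u, v) = 0 := huv
    have h₁ := (hd.hasFDerivAt.fst).fderiv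
    have h₂ := (hd.hasFDerivAt.snd).fderiv
    have key : ∀ f : ℝ × ℝ → ℝ, curveDeriv f p u v = fderiv ℝ f p (u, v) := by
      intro f
      rw [show ((u, v) : ℝ × ℝ) = u • (1, 0) + v • (0, 1) by simp, map_add, map_smul, map_smul]
      simp [curveDeriv, partialX, partialY, mul_comm]
    obtain ⟨hu, hv⟩ := h.eq_zero_of_curveDeriv hp (u := u) (v := v)
      (by rw [key, h₁]; simp [e]) (by rw [key, h₂]; simp [e])
    simp [hu, hv]
  refine ⟨(LinearEquiv.ofInjectiveEndo _ hinj).toContinuousLinearEquiv, ?_⟩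
  refine hd.hasFDerivAt.congr_fderiv ?_
  ext <;> rfl

/-- A point transformation is injective near each point. -/
theorem exists_injOn (h : IsPointTransformation Φ V) (hp : p ∈ V) :
    ∃ W : Set (ℝ × ℝ), IsOpen W ∧ p ∈ W ∧ W ⊆ V ∧ Set.InjOn Φ W := by
  obtain ⟨L, hL⟩ := h.exists_equiv hp
  have hc := h.smooth.contDiffAt (h.isOpen.mem_nhds hp)
  let e := hc.toOpenPartialHomeomorph Φ hL (by simp)
  refine ⟨e.source ∩ V, e.open_source.inter h.isOpen,
    ⟨hc.mem_toOpenPartialHomeomorph_source hL (by simp), hp⟩, Set.inter_subset_right, ?_⟩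
  exact e.injOn.mono Set.inter_subset_left

theorem image_mem_nhds (h : IsPointTransformation Φ V) (hp : p ∈ V) : Φ '' V ∈ 𝓝 (Φ p) := by
  obtain ⟨L, hL⟩ := h.exists_equiv hp
  have hc := h.smooth.contDiffAt (h.isOpen.mem_nhds hp)
  rw [← (hc.hasStrictFDerivAt' hL (by simp)).map_nhds_eq_of_equiv]
  exact Filter.image_mem_map (h.isOpen.mem_nhds hp)

theorem isOpen_image (h : IsPointTransformation Φ V) : IsOpen (Φ '' V) := by
  rw [isOpen_iff_mem_nhds]
  rintro _ ⟨q, hq, rfl⟩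
  exact h.image_mem_nhds hq

theorem isOpen_image_fst (h : IsPointTransformation Φ V) :
    IsOpen ((fun q => (Φ q).1) '' V) := by
  rw [show (fun q => (Φ q).1) '' V = Prod.fst '' (Φ '' V) from
    (Set.image_image Prod.fst Φ V).symm]
  exact isOpenMap_fst _ h.isOpen_image

theorem comp {Ψ : ℝ × ℝ → ℝ × ℝ} {W : Set (ℝ × ℝ)} (hΨ : IsPointTransformation Ψ W)
    (h : IsPointTransformation Φ V) (hVW : Set.MapsTo Φ V W) :
    IsPointTransformation (Ψ ∘ Φ) V := by
  refine ⟨h.isOpen, hΨ.smooth.comp h.smooth hVW, fun q hq => ?_⟩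
  have e : planeJacobian (Ψ ∘ Φ) q = planeJacobian Ψ (Φ q) * planeJacobian Φ q := by
    have lin : ∀ z : ℝ × ℝ, fderiv ℝ Ψ (Φ q) z
        = z.1 • fderiv ℝ Ψ (Φ q) (1, 0) + z.2 • fderiv ℝ Ψ (Φ q) (0, 1) := by
      intro z
      rw [← map_smul, ← map_smul, ← map_add]
      simp
    unfold planeJacobian
    rw [fderiv_comp _ (hΨ.differentiableAt (hVW hq)) (h.differentiableAt hq)]
    simp only [ContinuousLinearMap.comp_apply]
    rw [lin (fderiv ℝ Φ q (1, 0)), lin (fderiv ℝ Φ q (0, 1))]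
    simp only [Prod.fst_add, Prod.snd_add, Prod.smul_fst, Prod.smul_snd, smul_eq_mul]
    ring
  rw [e]
  exact mul_ne_zero (hΨ.jacobian_ne_zero _ (hVW hq)) (h.jacobian_ne_zero _ hq)

end IsPointTransformation

/-- Rewriting `w'' + a w' + b` in a parametrization `s ↦ (Z s, W s)` of the graph of `w`. The
parametrization is automatically transversal to the vertical direction, since `w` is
differentiable. -/
theorem graph_parametrization {Z W w : ℝ → ℝ} {x : ℝ} (hZ : ContDiffAt ℝ 2 Z x)
    (hw : ContDiffAt ℝ 2 w (Z x)) (h : ∀ᶠ s in 𝓝 x, w (Z s) = W s)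
    (hreg : deriv Z x = 0 → deriv W x = 0 → False) :
    deriv Z x ≠ 0 ∧ ∀ a b : ℝ,
      (deriv (deriv w) (Z x) + a * deriv w (Z x) + b) * deriv Z x ^ 3
        = deriv (deriv W) x * deriv Z x - deriv W x * deriv (deriv Z) x
          + a * deriv W x * deriv Z x ^ 2 + b * deriv Z x ^ 3 := by
  obtain ⟨h₁, h₂⟩ := deriv_deriv_comp hZ hw
  have e : (fun s => w (Z s)) =ᶠ[𝓝 x] W := h
  rw [e.deriv_eq] at h₁
  rw [e.deriv.deriv_eq] at h₂
  refine ⟨fun h0 => hreg h0 (by rw [h₁, h0, mul_zero]), fun a b => ?_⟩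
  rw [h₁, h₂]
  ring

section Jets

variable {Φ Ψ : ℝ × ℝ → ℝ × ℝ} {V W : Set (ℝ × ℝ)} {A₁ A₀ a b : ℝ × ℝ → ℝ}

/-- The jet identity evaluated along a curve. -/
theorem TransformsJets.along_curve (hΦ : IsPointTransformation Φ V)
    (hj : TransformsJets Φ V A₁ A₀ a b) {r t : ℝ → ℝ} {x : ℝ} (hp : (r x, t x) ∈ V)
    (hr : ContDiffAt ℝ 2 r x) (ht : ContDiffAt ℝ 2 t x)
    (hreg : deriv r x = 0 → deriv t x = 0 → False) :
    ContDiffAt ℝ 2 (fun s => (Φ (r s, t s)).1) x ∧ ContDiffAt ℝ 2 (fun s => (Φ (r s, t s)).2) x ∧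
    (deriv (fun s => (Φ (r s, t s)).1) x = 0 → deriv (fun s => (Φ (r s, t s)).2) x = 0 → False) ∧
    deriv (deriv (fun s => (Φ (r s, t s)).2)) x * deriv (fun s => (Φ (r s, t s)).1) x
        - deriv (fun s => (Φ (r s, t s)).2) x * deriv (deriv (fun s => (Φ (r s, t s)).1)) x
        + a (Φ (r x, t x)) * deriv (fun s => (Φ (r s, t s)).2) x
          * deriv (fun s => (Φ (r s, t s)).1) x ^ 2
        + b (Φ (r x, t x)) * deriv (fun s => (Φ (r s, t s)).1) x ^ 3
      = planeJacobian Φ (r x, t x) * (deriv (deriv t) x * deriv r x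
        - deriv t x * deriv (deriv r) x + A₁ (r x, t x) * deriv r x ^ 2 * deriv t x
        + A₀ (r x, t x) * deriv r x ^ 3) := by
  obtain ⟨c₁, d₁, e₁⟩ := deriv_deriv_along_curve hΦ.isOpen hΦ.smooth_fst hp hr ht
  obtain ⟨c₂, d₂, e₂⟩ := deriv_deriv_along_curve hΦ.isOpen hΦ.smooth_snd hp hr ht
  refine ⟨c₁, c₂, ?_, ?_⟩
  · rw [d₁, d₂]
    intro h₁ h₂
    obtain ⟨hu, hv⟩ := hΦ.eq_zero_of_curveDeriv hp h₁ h₂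
    exact hreg hu hv
  · rw [d₁, d₂, e₁, e₂]
    exact hj _ hp _ _ _ _

theorem deriv_id_eq_one (x : ℝ) : deriv (fun s : ℝ => s) x = 1 ∧
    deriv (deriv (fun s : ℝ => s)) x = 0 := by
  have : deriv (fun s : ℝ => s) = fun _ => 1 := by ext; simp
  simp [this]

/-- A transformation of jets transforms the equations. -/
theorem TransformsJets.mapsEquation {E₁ E₂ : ScalarODE} (hΦ : IsPointTransformation Φ V)
    (hj : TransformsJets Φ V A₁ A₀ a b) (h₁ : HasNormalForm E₁ A₁ A₀ V)
    (h₂ : HasNormalForm E₂ a b (Φ '' V)) : MapsEquation Φ V E₁ E₂ := by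
  intro y w x hp hy hw hev
  obtain ⟨i₁, i₂⟩ := deriv_id_eq_one x
  obtain ⟨c₁, c₂, reg, key⟩ := hj.along_curve hΦ (r := fun s => s) hp contDiffAt_id hy
    (by rw [i₁]; simp)
  obtain ⟨hne, hg⟩ := graph_parametrization c₁ hw hev reg
  have hpt : (Φ (x, y x)).2 = w (Φ (x, y x)).1 := hev.self_of_nhds.symm
  have hpt' : ((Φ (x, y x)).1, w (Φ (x, y x)).1) = Φ (x, y x) := Prod.ext rfl hpt.symm
  rw [h₁ y x hp hy, h₂ w _ (by rw [hpt']; exact Set.mem_image_of_mem Φ hp) hw, hpt']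
  have := hg (a (Φ (x, y x))) (b (Φ (x, y x)))
  rw [key, i₁, i₂] at this
  have hJ := hΦ.jacobian_ne_zero _ hp
  constructor
  · intro h
    refine (mul_eq_zero.1 (?_ : _ * deriv (fun s => (Φ (s, y s)).1) x ^ 3 = 0)).resolve_right
      (pow_ne_zero 3 hne)
    rw [this]
    linear_combination planeJacobian Φ (x, y x) * h
  · intro h
    rw [h, zero_mul] at this
    refine (mul_eq_zero.1 (?_ : planeJacobian Φ (x, y x) * _ = 0)).resolve_left hJ
    linear_combination -this

/-- Composition of a transformation of jets with another one transforms the equations. -/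
theorem TransformsJets.mapsEquation_comp {c d : ℝ × ℝ → ℝ} {E₁ E₂ : ScalarODE}
    (hΦ : IsPointTransformation Φ V) (hj : TransformsJets Φ V A₁ A₀ a b)
    (hΨ : IsPointTransformation Ψ W) (hj' : TransformsJets Ψ W a b c d)
    (hVW : Set.MapsTo Φ V W) (h₁ : HasNormalForm E₁ A₁ A₀ V)
    (h₂ : HasNormalForm E₂ c d (Ψ '' W)) : MapsEquation (Ψ ∘ Φ) V E₁ E₂ := by
  intro y w x hp hy hw hev
  obtain ⟨i₁, i₂⟩ := deriv_id_eq_one x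
  obtain ⟨c₁, c₂, reg, key⟩ := hj.along_curve hΦ (r := fun s => s) hp contDiffAt_id hy
    (by rw [i₁]; simp)
  obtain ⟨c₁', c₂', reg', key'⟩ := hj'.along_curve hΨ (x := x) (hVW hp) c₁ c₂ reg
  obtain ⟨hne, hg⟩ := graph_parametrization c₁' hw hev reg'
  simp only [Function.comp, Prod.mk.eta] at hw hev key' hne hg ⊢
  have hpt : (Ψ (Φ (x, y x))).2 = w (Ψ (Φ (x, y x))).1 := hev.self_of_nhds.symm
  have hpt' : ((Ψ (Φ (x, y x))).1, w (Ψ (Φ (x, y x))).1) = Ψ (Φ (x, y x)) :=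
    Prod.ext rfl hpt.symm
  rw [h₁ y x hp hy, h₂ w _ (by rw [hpt']; exact Set.mem_image_of_mem Ψ (hVW hp)) hw, hpt']
  have := hg (c (Ψ (Φ (x, y x)))) (d (Ψ (Φ (x, y x))))
  rw [key'] at this
  have hJ := mul_ne_zero (hΨ.jacobian_ne_zero _ (hVW hp)) (hΦ.jacobian_ne_zero _ hp)
  rw [i₁, i₂] at key
  constructor
  · intro h
    refine (mul_eq_zero.1 (?_ : _ * deriv (fun s => (Ψ (Φ (s, y s))).1) x ^ 3 = 0)).resolve_right
      (pow_ne_zero 3 hne)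
    rw [this]
    linear_combination planeJacobian Ψ (Φ (x, y x)) * key +
      planeJacobian Ψ (Φ (x, y x)) * planeJacobian Φ (x, y x) * h
  · intro h
    rw [h, zero_mul] at this
    refine (mul_eq_zero.1
      (?_ : (planeJacobian Ψ (Φ (x, y x)) * planeJacobian Φ (x, y x)) * _ = 0)).resolve_left hJ
    linear_combination -this - planeJacobian Ψ (Φ (x, y x)) * key

/-- A cubic polynomial that vanishes wherever a given nonzero affine function does not. -/
theorem cubic_coeffs_eq_zero {c₀ c₁ c₂ c₃ k l : ℝ} (hkl : k ≠ 0 ∨ l ≠ 0)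
    (h : ∀ m : ℝ, k + l * m ≠ 0 → c₀ + c₁ * m + c₂ * m ^ 2 + c₃ * m ^ 3 = 0) :
    c₀ = 0 ∧ c₁ = 0 ∧ c₂ = 0 ∧ c₃ = 0 := by
  have H : ∀ m : ℝ, (k + l * m) * (c₀ + c₁ * m + c₂ * m ^ 2 + c₃ * m ^ 3) = 0 := by
    intro m
    by_cases hm : k + l * m = 0
    · rw [hm, zero_mul]
    · rw [h m hm, mul_zero]
  have h0 := H 0
  have h1 := H 1
  have h2 := H (-1)
  have h3 := H 2
  have h4 := H (-2)
  have e0 : k * c₀ = 0 := by linarith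
  have e1 : l * c₀ + k * c₁ = 0 := by linarith
  have e2 : l * c₁ + k * c₂ = 0 := by linarith
  have e3 : l * c₂ + k * c₃ = 0 := by linarith
  have e4 : l * c₃ = 0 := by linarith
  by_cases hl : l = 0
  · have hk := hkl.resolve_right (not_not.2 hl)
    subst hl
    simp_all
  · have c3 := (mul_eq_zero.1 e4).resolve_left hl
    simp_all

/-- A point transformation that maps one equation to another transforms the jets. At slopes where
the image of a graph is not vertical the identity is read off from a parabola satisfying the first
equation at the given point, and the remaining slope is reached because the identity is polynomial
in the slope. -/
theorem MapsEquation.transformsJets {E₁ E₂ : ScalarODE} (hΦ : IsPointTransformation Φ V)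
    (hm : MapsEquation Φ V E₁ E₂) (h₁ : HasNormalForm E₁ A₁ A₀ V)
    (h₂ : HasNormalForm E₂ a b (Φ '' V)) : TransformsJets Φ V A₁ A₀ a b := by
  rintro ⟨x, y₀⟩ hp u v u₂ v₂
  have slope : ∀ m : ℝ, curveDeriv (fun q => (Φ q).1) (x, y₀) 1 m ≠ 0 →
      curveDeriv₂ (fun q => (Φ q).2) (x, y₀) 1 m 0 (-A₁ (x, y₀) * m - A₀ (x, y₀))
          * curveDeriv (fun q => (Φ q).1) (x, y₀) 1 m
        - curveDeriv (fun q => (Φ q).2) (x, y₀) 1 m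
          * curveDeriv₂ (fun q => (Φ q).1) (x, y₀) 1 m 0 (-A₁ (x, y₀) * m - A₀ (x, y₀))
        + a (Φ (x, y₀)) * curveDeriv (fun q => (Φ q).2) (x, y₀) 1 m
          * curveDeriv (fun q => (Φ q).1) (x, y₀) 1 m ^ 2
        + b (Φ (x, y₀)) * curveDeriv (fun q => (Φ q).1) (x, y₀) 1 m ^ 3 = 0 := by
    intro m hne
    obtain ⟨q, hq⟩ : ∃ q, q = -A₁ (x, y₀) * m - A₀ (x, y₀) := ⟨_, rfl⟩
    obtain ⟨y, hydef⟩ : ∃ y : ℝ → ℝ, y = fun s => y₀ + m * (s - x) + q / 2 * (s - x) ^ 2 :=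
      ⟨_, rfl⟩
    have hyx : y x = y₀ := by simp [hydef]
    have hy : ContDiffAt ℝ 2 y x := by rw [hydef]; fun_prop
    have hy' : deriv y = fun s => m + q * (s - x) := by
      ext s
      have := ((((hasDerivAt_id s).sub_const x).const_mul m).const_add y₀).add
        ((((hasDerivAt_id s).sub_const x).pow 2).const_mul (q / 2))
      rw [hydef]
      refine HasDerivAt.deriv (this.congr_deriv ?_)
      simp
      ring
    have hy1 : deriv y x = m := by simp [hy']
    have hy2 : deriv (deriv y) x = q := by
      rw [hy']
      simp
    obtain ⟨i₁, i₂⟩ := deriv_id_eq_one x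
    have hp' : (x, y x) ∈ V := by rw [hyx]; exact hp
    obtain ⟨c₁, d₁, e₁⟩ := deriv_deriv_along_curve (r := fun s => s) hΦ.isOpen hΦ.smooth_fst hp'
      contDiffAt_id hy
    obtain ⟨c₂, d₂, e₂⟩ := deriv_deriv_along_curve (r := fun s => s) hΦ.isOpen hΦ.smooth_snd hp'
      contDiffAt_id hy
    rw [hyx, i₁, hy1] at d₁ d₂
    rw [hyx, i₁, i₂, hy1, hy2] at e₁ e₂
    have hne' : deriv (fun s => (Φ (s, y s)).1) x ≠ 0 := by rw [d₁]; exact hne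
    -- `w` is obtained by inverting the first component along the graph of `y`.
    let L := ContinuousLinearEquiv.unitsEquivAut ℝ (Units.mk0 _ hne')
    have hL : HasFDerivAt (fun s => (Φ (s, y s)).1) (L : ℝ →L[ℝ] ℝ) x :=
      c₁.hasDerivAt_of_two.hasFDerivAt_equiv hne'
    have hstrict := c₁.hasStrictFDerivAt' hL (by simp)
    let σ := c₁.localInverse hL (by simp)
    have hσx : σ (Φ (x, y x)).1 = x := c₁.localInverse_apply_image hL (by simp)
    have hσ : ContDiffAt ℝ 2 σ (Φ (x, y x)).1 := c₁.to_localInverse hL (by simp)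
    have hσl : ∀ᶠ s in 𝓝 x, σ (Φ (s, y s)).1 = s := hstrict.eventually_left_inverse
    have hw : ContDiffAt ℝ 2 (fun z => (Φ (σ z, y (σ z))).2) (Φ (x, y x)).1 := by
      have : ContDiffAt ℝ 2 (fun s => (Φ (s, y s)).2) (σ (Φ (x, y x)).1) := by rw [hσx]; exact c₂
      exact this.comp _ hσ
    have hev : ∀ᶠ s in 𝓝 x, (fun z => (Φ (σ z, y (σ z))).2) (Φ (s, y s)).1 = (Φ (s, y s)).2 := by
      filter_upwards [hσl] with s hs
      simp only [hs]
    have sol := (hm y _ x hp' hy hw hev).1 ((h₁ y x hp' hy).2 (by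
      rw [hyx, hy1, hy2, hq]; ring))
    obtain ⟨-, hg⟩ := graph_parametrization c₁ hw hev fun h _ => hne' h
    have hpt' : ((Φ (x, y x)).1, (fun z => (Φ (σ z, y (σ z))).2) (Φ (x, y x)).1)
        = Φ (x, y x) := by simp only [hσx]
    have nf := (h₂ _ _ (by rw [hpt']; exact Set.mem_image_of_mem Φ hp') hw).1 sol
    rw [hpt'] at nf
    have := hg (a (Φ (x, y x))) (b (Φ (x, y x)))
    rw [nf, zero_mul, d₁, d₂, e₁, e₂, hyx] at this
    rw [← hq]
    exact this.symm
  have hJ := hΦ.jacobian_partials_ne_zero hp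
  rw [planeJacobian_eq (hΦ.differentiableAt hp)]
  unfold curveDeriv curveDeriv₂ at slope ⊢
  generalize partialX (partialX fun q => (Φ q).1) (x, y₀) = r₁₁ at *
  generalize partialX (partialY fun q => (Φ q).1) (x, y₀) = r₁₂ at *
  generalize partialY (partialY fun q => (Φ q).1) (x, y₀) = r₂₂ at *
  generalize partialX (partialX fun q => (Φ q).2) (x, y₀) = s₁₁ at *
  generalize partialX (partialY fun q => (Φ q).2) (x, y₀) = s₁₂ at *
  generalize partialY (partialY fun q => (Φ q).2) (x, y₀) = s₂₂ at *
  generalize partialX (fun q => (Φ q).1) (x, y₀) = r₁ at *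
  generalize partialY (fun q => (Φ q).1) (x, y₀) = r₂ at *
  generalize partialX (fun q => (Φ q).2) (x, y₀) = s₁ at *
  generalize partialY (fun q => (Φ q).2) (x, y₀) = s₂ at *
  generalize A₁ (x, y₀) = α₁ at *
  generalize A₀ (x, y₀) = α₀ at *
  generalize a (Φ (x, y₀)) = κ at *
  generalize b (Φ (x, y₀)) = μ at *
  obtain ⟨z₀, z₁, z₂, z₃⟩ := cubic_coeffs_eq_zero (k := r₁) (l := r₂)
    (c₀ := s₁₁ * r₁ - s₁ * r₁₁ + κ * s₁ * r₁ ^ 2 + μ * r₁ ^ 3 - (r₁ * s₂ - r₂ * s₁) * α₀)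
    (c₁ := s₁₁ * r₂ + 2 * s₁₂ * r₁ - s₂ * r₁₁ - 2 * s₁ * r₁₂
      + κ * (2 * s₁ * r₁ * r₂ + s₂ * r₁ ^ 2) + 3 * μ * r₁ ^ 2 * r₂ - (r₁ * s₂ - r₂ * s₁) * α₁)
    (c₂ := 2 * s₁₂ * r₂ + s₂₂ * r₁ - 2 * s₂ * r₁₂ - s₁ * r₂₂
      + κ * (s₁ * r₂ ^ 2 + 2 * s₂ * r₁ * r₂) + 3 * μ * r₁ * r₂ ^ 2)
    (c₃ := s₂₂ * r₂ - s₂ * r₂₂ + κ * s₂ * r₂ ^ 2 + μ * r₂ ^ 3)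
    (by
      by_contra hcon
      push Not at hcon
      exact hJ (by rw [hcon.1, hcon.2]; ring))
    (by
      intro m hmne
      have := slope m (by simpa using hmne)
      linear_combination this)
  linear_combination u ^ 3 * z₀ + u ^ 2 * v * z₁ + u * v ^ 2 * z₂ + v ^ 3 * z₃

end Jets

/-! ### Lie's linearizability conditions -/

section Compatibility

variable {f : ℝ × ℝ → ℝ} {V : Set (ℝ × ℝ)} {p : ℝ × ℝ}

theorem cross_partials_eq {g₁ g₂ : ℝ × ℝ → ℝ} {a₁ a₂ b₁ b₂ : ℝ} (hV : IsOpen V)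
    (hf : ContDiffOn ℝ ∞ f V) (h₁ : ∀ q ∈ V, partialX f q = g₁ q)
    (h₂ : ∀ q ∈ V, partialY f q = g₂ q) (hp : p ∈ V)
    (hg₁ : HasPartials g₁ a₁ a₂ p) (hg₂ : HasPartials g₂ b₁ b₂ p) : a₂ = b₁ := by
  have e₁ := (hg₁.congr_of_eventuallyEq
    (Filter.eventuallyEq_of_mem (hV.mem_nhds hp) h₁)).partialY_eq
  have e₂ := (hg₂.congr_of_eventuallyEq
    (Filter.eventuallyEq_of_mem (hV.mem_nhds hp) h₂)).partialX_eq
  rw [← e₁, ← e₂]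
  exact (hf.partialX_partialY hV hp).symm

theorem cross_second_partials_eq {g₁₁ g₁₂ g₂₂ : ℝ × ℝ → ℝ} {a₁ a₂ b₁ b₂ c₁ c₂ : ℝ}
    (hV : IsOpen V) (hf : ContDiffOn ℝ ∞ f V)
    (h₁₁ : ∀ q ∈ V, partialX (partialX f) q = g₁₁ q)
    (h₁₂ : ∀ q ∈ V, partialX (partialY f) q = g₁₂ q)
    (h₂₂ : ∀ q ∈ V, partialY (partialY f) q = g₂₂ q) (hp : p ∈ V)
    (hg₁₁ : HasPartials g₁₁ a₁ a₂ p) (hg₁₂ : HasPartials g₁₂ b₁ b₂ p)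
    (hg₂₂ : HasPartials g₂₂ c₁ c₂ p) : a₂ = b₁ ∧ b₂ = c₁ :=
  ⟨cross_partials_eq hV (hf.partialX hV) h₁₁
      (fun q hq => (hf.partialX_partialY hV hq).symm.trans (h₁₂ q hq)) hp hg₁₁ hg₁₂,
    cross_partials_eq hV (hf.partialY hV) h₁₂ h₂₂ hp hg₁₂ hg₂₂⟩

end Compatibility

section Lie

variable {Φ : ℝ × ℝ → ℝ × ℝ} {V : Set (ℝ × ℝ)} {A₁ A₀ : ℝ × ℝ → ℝ}

/-- The second derivatives of the components `ρ`, `ψ` of a point transformation from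
`y'' + A₁ y' + A₀ = 0` to `w'' + a w' + B = 0`: the four coefficients of the jet identity
determine the six of them up to two functions `η`, `θ`. -/
theorem TransformsJets.exists_second_partials {a B : ℝ × ℝ → ℝ}
    (hΦ : IsPointTransformation Φ V) (hj : TransformsJets Φ V A₁ A₀ a B)
    (ha : ContDiffOn ℝ ∞ (fun q => a (Φ q)) V) (hB : ContDiffOn ℝ ∞ (fun q => B (Φ q)) V)
    {ρ ψ : ℝ × ℝ → ℝ} (hρ : ρ = fun q => (Φ q).1) (hψ : ψ = fun q => (Φ q).2) :
    ∃ η θ : ℝ × ℝ → ℝ, ContDiffOn ℝ ∞ η V ∧ ContDiffOn ℝ ∞ θ V ∧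
      (∀ p ∈ V, partialX (partialX ρ) p
        = A₀ p * partialY ρ p + (2 * η p - A₁ p) * partialX ρ p) ∧
      (∀ p ∈ V, partialX (partialY ρ) p = η p * partialY ρ p + θ p * partialX ρ p) ∧
      (∀ p ∈ V, partialY (partialY ρ) p = 2 * (θ p * partialY ρ p)) ∧
      (∀ p ∈ V, partialX (partialX ψ) p
        = A₀ p * partialY ψ p + (2 * η p - A₁ p) * partialX ψ p
          - (a (Φ p) * (partialX ρ p * partialX ψ p)
            + B (Φ p) * (partialX ρ p * partialX ρ p))) ∧
      (∀ p ∈ V, partialX (partialY ψ) p = η p * partialY ψ p + θ p * partialX ψ p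
          - (a (Φ p) * (1 / 2 * (partialX ρ p * partialY ψ p + partialY ρ p * partialX ψ p))
            + B (Φ p) * (partialX ρ p * partialY ρ p))) ∧
      (∀ p ∈ V, partialY (partialY ψ) p = 2 * (θ p * partialY ψ p)
          - (a (Φ p) * (partialY ρ p * partialY ψ p)
            + B (Φ p) * (partialY ρ p * partialY ρ p))) := by
  have hV := hΦ.isOpen
  have sρ : ContDiffOn ℝ ∞ ρ V := hρ ▸ hΦ.smooth_fst
  have sψ : ContDiffOn ℝ ∞ ψ V := hψ ▸ hΦ.smooth_snd
  have hJ : ∀ p ∈ V, partialX ρ p * partialY ψ p - partialY ρ p * partialX ψ p ≠ 0 := by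
    subst hρ hψ
    exact fun p hp => hΦ.jacobian_partials_ne_zero hp
  obtain ⟨J, hJdef⟩ : ∃ J : ℝ × ℝ → ℝ,
      J = fun q => partialX ρ q * partialY ψ q - partialY ρ q * partialX ψ q := ⟨_, rfl⟩
  obtain ⟨E, hE⟩ : ∃ E : ℝ × ℝ → ℝ, E = fun q => partialX (partialY ψ) q
      + a (Φ q) * (1 / 2 * (partialX ρ q * partialY ψ q + partialY ρ q * partialX ψ q))
      + B (Φ q) * (partialX ρ q * partialY ρ q) := ⟨_, rfl⟩
  have sρ₁ := sρ.partialX hV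
  have sρ₂ := sρ.partialY hV
  have sψ₁ := sψ.partialX hV
  have sψ₂ := sψ.partialY hV
  have sJ : ContDiffOn ℝ ∞ J V := hJdef ▸ (sρ₁.mul sψ₂).sub (sρ₂.mul sψ₁)
  have sE : ContDiffOn ℝ ∞ E V := hE ▸ ((sψ₂.partialX hV).add
    (ha.mul (contDiffOn_const.mul ((sρ₁.mul sψ₂).add (sρ₂.mul sψ₁))))).add
      (hB.mul (sρ₁.mul sρ₂))
  have hJ0 : ∀ p ∈ V, J p ≠ 0 := by rw [hJdef]; exact hJ
  -- `η` and `θ` solve the linear system given by the two mixed second derivatives.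
  obtain ⟨η, hη⟩ : ∃ η : ℝ × ℝ → ℝ,
      η = fun q => (partialX ρ q * E q - partialX ψ q * partialX (partialY ρ) q) / J q := ⟨_, rfl⟩
  obtain ⟨θ, hθ⟩ : ∃ θ : ℝ × ℝ → ℝ,
      θ = fun q => (partialX (partialY ρ) q * partialY ψ q - E q * partialY ρ q) / J q := ⟨_, rfl⟩
  have sη : ContDiffOn ℝ ∞ η V :=
    hη ▸ ((sρ₁.mul sE).sub (sψ₁.mul (sρ₂.partialX hV))).div sJ hJ0
  have sθ : ContDiffOn ℝ ∞ θ V :=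
    hθ ▸ (((sρ₂.partialX hV).mul sψ₂).sub (sE.mul sρ₂)).div sJ hJ0
  have eη : ∀ p ∈ V, η p * J p
      = partialX ρ p * E p - partialX ψ p * partialX (partialY ρ) p := by
    intro p hp; rw [hη]; exact div_mul_cancel₀ _ (hJ0 p hp)
  have eθ : ∀ p ∈ V, θ p * J p
      = partialX (partialY ρ) p * partialY ψ p - E p * partialY ρ p := by
    intro p hp; rw [hθ]; exact div_mul_cancel₀ _ (hJ0 p hp)
  have coeffs : ∀ p ∈ V, ∀ u v : ℝ, _ := fun p hp u v => hj p hp u v 0 0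
  refine ⟨η, θ, sη, sθ, ?_⟩
  refine ⟨fun p hp => ?_, fun p hp => ?_, fun p hp => ?_, fun p hp => ?_, fun p hp => ?_,
    fun p hp => ?_⟩ <;>
  (have h10 := coeffs p hp 1 0
   have h01 := coeffs p hp 0 1
   have h11 := coeffs p hp 1 1
   have h12 := coeffs p hp 1 (-1)
   have e₁ := eη p hp
   have e₂ := eθ p hp
   have j0 := hJ0 p hp
   have hJp : J p = partialX ρ p * partialY ψ p - partialY ρ p * partialX ψ p := by rw [hJdef]
   have hEp : E p = partialX (partialY ψ) p
      + a (Φ p) * (1 / 2 * (partialX ρ p * partialY ψ p + partialY ρ p * partialX ψ p))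
      + B (Φ p) * (partialX ρ p * partialY ρ p) := by rw [hE]
   rw [planeJacobian_eq (hΦ.differentiableAt hp), ← hρ, ← hψ, ← hJp] at h10 h01 h11 h12
   unfold curveDeriv curveDeriv₂ at h10 h01 h11 h12
   generalize partialX (partialX ρ) p = r₁₁ at *
   generalize partialX (partialY ρ) p = r₁₂ at *
   generalize partialY (partialY ρ) p = r₂₂ at *
   generalize partialX (partialX ψ) p = s₁₁ at *
   generalize partialX (partialY ψ) p = s₁₂ at *
   generalize partialY (partialY ψ) p = s₂₂ at *
   generalize partialX ρ p = r₁ at *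
   generalize partialY ρ p = r₂ at *
   generalize partialX ψ p = s₁ at *
   generalize partialY ψ p = s₂ at *
   generalize A₁ p = α₁ at *
   generalize A₀ p = α₀ at *
   generalize a (Φ p) = κ at *
   generalize B (Φ p) = μ at *
   generalize η p = y at *
   generalize θ p = t at *
   generalize J p = j at *
   generalize E p = e at *
   have p0 : (s₁₁ + κ * (r₁ * s₁) + μ * (r₁ * r₁)) * r₁ - r₁₁ * s₁ = j * α₀ := by
     linear_combination h10
   have p3 : (s₂₂ + κ * (r₂ * s₂) + μ * (r₂ * r₂)) * r₂ - r₂₂ * s₂ = 0 := by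
     linear_combination h01
   have p1 : (s₁₁ + κ * (r₁ * s₁) + μ * (r₁ * r₁)) * r₂ - r₁₁ * s₂ + 2 * e * r₁ - 2 * r₁₂ * s₁
      = j * α₁ := by
     rw [hEp]; linear_combination (1 / 2 : ℝ) * (h11 - h12) - h01
   have p2 : (s₂₂ + κ * (r₂ * s₂) + μ * (r₂ * r₂)) * r₁ - r₂₂ * s₁ + 2 * e * r₂ - 2 * r₁₂ * s₂
      = 0 := by
     rw [hEp]; linear_combination (1 / 2 : ℝ) * (h11 + h12) - h10
   refine mul_left_cancel₀ j0 ?_)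
  · rw [mul_add, ← mul_assoc, ← p0]
    linear_combination r₁₁ * hJp - r₁ * p1 - 2 * r₁ * e₁
  · linear_combination r₁₂ * hJp - r₂ * e₁ - r₁ * e₂
  · linear_combination r₂₂ * hJp - r₁ * p3 + r₂ * p2 - 2 * r₂ * e₂
  · linear_combination (s₁₁ + κ * (r₁ * s₁) + μ * (r₁ * r₁)) * hJp + s₂ * p0 - s₁ * p1
      - 2 * s₁ * e₁
  · linear_combination e * hJp - s₂ * e₁ - s₁ * e₂ - j * hEp
  · linear_combination (s₂₂ + κ * (r₂ * s₂) + μ * (r₂ * r₂)) * hJp - s₁ * p3 + s₂ * p2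
      - 2 * s₂ * e₂

theorem eq_zero_of_two_combinations {r₁ r₂ s₁ s₂ c d : ℝ} (hJ : r₁ * s₂ - r₂ * s₁ ≠ 0)
    (h : c * r₁ + d * r₂ = 0) (h' : c * s₁ + d * s₂ = 0) : c = 0 ∧ d = 0 := by
  constructor
  · exact (mul_eq_zero.1 (by linear_combination s₂ * h - r₂ * h' :
      (r₁ * s₂ - r₂ * s₁) * c = 0)).resolve_left hJ
  · exact (mul_eq_zero.1 (by linear_combination r₁ * h' - s₁ * h :
      (r₁ * s₂ - r₂ * s₁) * d = 0)).resolve_left hJ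

/-- The compatibility conditions of the second derivatives of `ρ` and `ψ` form a Riccati system
for `η` and `θ`. The target `w'' + a w' + b w + c = 0` enters only through its invariant
`k = a' / 2 + a² / 4 - b`. -/
theorem TransformsJets.exists_riccati {a b c : ℝ → ℝ} (hΦ : IsPointTransformation Φ V)
    (hj : TransformsJets Φ V A₁ A₀ (fun q => a q.1) (fun q => b q.1 * q.2 + c q.1))
    (hA₁ : ContDiffOn ℝ ∞ A₁ V) (hA₀ : ContDiffOn ℝ ∞ A₀ V)
    (ha : ContDiffOn ℝ ∞ a ((fun q => (Φ q).1) '' V))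
    (hb : ContDiffOn ℝ ∞ b ((fun q => (Φ q).1) '' V))
    (hc : ContDiffOn ℝ ∞ c ((fun q => (Φ q).1) '' V))
    {ρ : ℝ × ℝ → ℝ} (hρ : ρ = fun q => (Φ q).1) :
    ∃ (η θ : ℝ × ℝ → ℝ) (k : ℝ → ℝ), ContDiffOn ℝ ∞ η V ∧ ContDiffOn ℝ ∞ θ V ∧
      (∀ p ∈ V, DifferentiableAt ℝ k (ρ p)) ∧
      (∀ p ∈ V, partialX (partialX ρ) p
        = A₀ p * partialY ρ p + (2 * η p - A₁ p) * partialX ρ p) ∧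
      (∀ p ∈ V, partialX (partialY ρ) p = η p * partialY ρ p + θ p * partialX ρ p) ∧
      (∀ p ∈ V, partialY (partialY ρ) p = 2 * (θ p * partialY ρ p)) ∧
      (∀ p ∈ V, partialX η p = partialY A₀ p + A₀ p * θ p + η p * η p - A₁ p * η p
        + k (ρ p) * (partialX ρ p * partialX ρ p)) ∧
      (∀ p ∈ V, partialY η p = 2 / 3 * partialY A₁ p + η p * θ p
        + k (ρ p) * (partialX ρ p * partialY ρ p)) ∧
      (∀ p ∈ V, partialX θ p = 1 / 3 * partialY A₁ p + η p * θ p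
        + k (ρ p) * (partialX ρ p * partialY ρ p)) ∧
      (∀ p ∈ V, partialY θ p = θ p * θ p + k (ρ p) * (partialY ρ p * partialY ρ p)) := by
  have hV := hΦ.isOpen
  obtain ⟨ψ, hψ⟩ : ∃ ψ : ℝ × ℝ → ℝ, ψ = fun q => (Φ q).2 := ⟨_, rfl⟩
  have hΦeq : ∀ q, Φ q = (ρ q, ψ q) := by intro q; rw [hρ, hψ]
  have sρ : ContDiffOn ℝ ∞ ρ V := hρ ▸ hΦ.smooth_fst
  have sψ : ContDiffOn ℝ ∞ ψ V := hψ ▸ hΦ.smooth_snd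
  have hI : IsOpen (ρ '' V) := by rw [hρ]; exact hΦ.isOpen_image_fst
  rw [← hρ] at ha hb hc
  have hmaps : Set.MapsTo ρ V (ρ '' V) := Set.mapsTo_image ρ V
  have hJ : ∀ p ∈ V, partialX ρ p * partialY ψ p - partialY ρ p * partialX ψ p ≠ 0 := by
    intro p hp
    have := hΦ.jacobian_partials_ne_zero hp
    rwa [← hρ, ← hψ] at this
  have saρ : ContDiffOn ℝ ∞ (fun q => a (Φ q).1) V := by
    simp only [hΦeq]; exact ha.comp sρ hmaps
  have sB : ContDiffOn ℝ ∞ (fun q => b (Φ q).1 * (Φ q).2 + c (Φ q).1) V := by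
    simp only [hΦeq]; exact ((hb.comp sρ hmaps).mul sψ).add (hc.comp sρ hmaps)
  obtain ⟨η, θ, sη, sθ, ρ₁₁, ρ₁₂, ρ₂₂, ψ₁₁, ψ₁₂, ψ₂₂⟩ :=
    hj.exists_second_partials hΦ saρ sB hρ hψ
  simp only [hΦeq] at ψ₁₁ ψ₁₂ ψ₂₂
  have hd : ∀ {h : ℝ → ℝ}, ContDiffOn ℝ ∞ h (ρ '' V) → ∀ p ∈ V,
      HasDerivAt h (deriv h (ρ p)) (ρ p) := fun hh p hp =>
    ((hh.contDiffAt (hI.mem_nhds (hmaps hp))).differentiableAt (by simp)).hasDerivAt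
  have key : ∀ p ∈ V,
      (partialY θ p - θ p * θ p
          - (deriv a (ρ p) / 2 + a (ρ p) ^ 2 / 4 - b (ρ p)) * (partialY ρ p * partialY ρ p) = 0 ∧
        partialY η p + η p * θ p - 2 * partialX θ p
          + (deriv a (ρ p) / 2 + a (ρ p) ^ 2 / 4 - b (ρ p)) * (partialX ρ p * partialY ρ p) = 0) ∧
      (2 * partialY η p - partialY A₁ p - η p * θ p - partialX θ p
          - (deriv a (ρ p) / 2 + a (ρ p) ^ 2 / 4 - b (ρ p)) * (partialX ρ p * partialY ρ p) = 0 ∧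
        partialY A₀ p + A₀ p * θ p + η p * η p - A₁ p * η p - partialX η p
          + (deriv a (ρ p) / 2 + a (ρ p) ^ 2 / 4 - b (ρ p))
            * (partialX ρ p * partialX ρ p) = 0) := by
    intro p hp
    have dη := sη.hasPartials hV hp
    have dθ := sθ.hasPartials hV hp
    have dA₁ := hA₁.hasPartials hV hp
    have dA₀ := hA₀.hasPartials hV hp
    have dρ := sρ.hasPartials hV hp
    have dψ := sψ.hasPartials hV hp
    have dρ₁ := sρ.hasPartials_partialX hV hp
    have dρ₂ := sρ.hasPartials_partialY hV hp
    have dψ₁ := sψ.hasPartials_partialX hV hp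
    have dψ₂ := sψ.hasPartials_partialY hV hp
    have da := dρ.comp (hd ha p hp)
    have dB := ((dρ.comp (hd hb p hp)).mul dψ).add (dρ.comp (hd hc p hp))
    have d2 : HasPartials (fun _ => (2 : ℝ)) 0 0 p := .const 2
    have d12 : HasPartials (fun _ => (1 / 2 : ℝ)) 0 0 p := .const (1 / 2)
    obtain ⟨cρ, cρ'⟩ := cross_second_partials_eq hV sρ ρ₁₁ ρ₁₂ ρ₂₂ hp
      ((dA₀.mul dρ₂).add (((d2.mul dη).sub dA₁).mul dρ₁))
      ((dη.mul dρ₂).add (dθ.mul dρ₁)) (d2.mul (dθ.mul dρ₂))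
    obtain ⟨cψ, cψ'⟩ := cross_second_partials_eq hV sψ ψ₁₁ ψ₁₂ ψ₂₂ hp
      (((dA₀.mul dψ₂).add (((d2.mul dη).sub dA₁).mul dψ₁)).sub
        ((da.mul (dρ₁.mul dψ₁)).add (dB.mul (dρ₁.mul dρ₁))))
      (((dη.mul dψ₂).add (dθ.mul dψ₁)).sub
        ((da.mul (d12.mul ((dρ₁.mul dψ₂).add (dρ₂.mul dψ₁)))).add (dB.mul (dρ₁.mul dρ₂))))
      ((d2.mul (dθ.mul dψ₂)).sub
        ((da.mul (dρ₂.mul dψ₂)).add (dB.mul (dρ₂.mul dρ₂))))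
    rw [ρ₁₁ p hp, ρ₁₂ p hp, ρ₂₂ p hp] at cρ
    rw [ρ₂₂ p hp, ρ₁₂ p hp] at cρ'
    rw [ρ₁₁ p hp, ρ₁₂ p hp, ψ₁₁ p hp, ψ₁₂ p hp, ψ₂₂ p hp] at cψ
    rw [ρ₂₂ p hp, ρ₁₂ p hp, ψ₂₂ p hp, ψ₁₂ p hp] at cψ'
    exact ⟨eq_zero_of_two_combinations (hJ p hp) (by linear_combination cρ')
        (by linear_combination cψ'),
      eq_zero_of_two_combinations (hJ p hp) (by linear_combination cρ)
        (by linear_combination cψ)⟩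
  refine ⟨η, θ, fun z => deriv a z / 2 + a z ^ 2 / 4 - b z, sη, sθ, ?_, ρ₁₁, ρ₁₂, ρ₂₂,
    ?_, ?_, ?_, ?_⟩
  · intro p hp
    have hd' : ContDiffOn ℝ ∞ (deriv a) (ρ '' V) :=
      ((contDiffOn_infty_iff_deriv_of_isOpen hI).1 ha).2
    exact (((hd hd' p hp).differentiableAt.div_const 2).add
      (((hd ha p hp).differentiableAt.pow 2).div_const 4)).sub (hd hb p hp).differentiableAt
  all_goals
    intro p hp
    obtain ⟨⟨k₁, k₂⟩, k₃, k₄⟩ := key p hp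
    linarith

/-- Lie's conditions: they are the integrability conditions of the Riccati system for `η`, `θ`. -/
theorem TransformsJets.lie_conditions {a b c : ℝ → ℝ} (hΦ : IsPointTransformation Φ V)
    (hj : TransformsJets Φ V A₁ A₀ (fun q => a q.1) (fun q => b q.1 * q.2 + c q.1))
    (hA₁ : ContDiffOn ℝ ∞ A₁ V) (hA₀ : ContDiffOn ℝ ∞ A₀ V)
    (ha : ContDiffOn ℝ ∞ a ((fun q => (Φ q).1) '' V))
    (hb : ContDiffOn ℝ ∞ b ((fun q => (Φ q).1) '' V))
    (hc : ContDiffOn ℝ ∞ c ((fun q => (Φ q).1) '' V)) :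
    ∀ p ∈ V, partialY (partialY A₁) p = 0 ∧
      partialY (partialY A₀) p
        = 2 / 3 * (partialX (partialY A₁) p + A₁ p * partialY A₁ p) := by
  obtain ⟨ρ, hρ⟩ : ∃ ρ : ℝ × ℝ → ℝ, ρ = fun q => (Φ q).1 := ⟨_, rfl⟩
  obtain ⟨η, θ, k, sη, sθ, hk, ρ₁₁, ρ₁₂, ρ₂₂, η₁, η₂, θ₁, θ₂⟩ :=
    hj.exists_riccati hΦ hA₁ hA₀ ha hb hc hρ
  intro p hp
  have hV := hΦ.isOpen
  have sρ : ContDiffOn ℝ ∞ ρ V := hρ ▸ hΦ.smooth_fst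
  have dη := sη.hasPartials hV hp
  have dθ := sθ.hasPartials hV hp
  have dA₁ := hA₁.hasPartials hV hp
  have dA₀ := hA₀.hasPartials hV hp
  have dA₁' := hA₁.hasPartials_partialY hV hp
  have dA₀' := hA₀.hasPartials_partialY hV hp
  have dρ := sρ.hasPartials hV hp
  have dρ₁ := sρ.hasPartials_partialX hV hp
  have dρ₂ := sρ.hasPartials_partialY hV hp
  have dk := dρ.comp (hk p hp).hasDerivAt
  have d23 : HasPartials (fun _ => (2 / 3 : ℝ)) 0 0 p := .const (2 / 3)
  have d13 : HasPartials (fun _ => (1 / 3 : ℝ)) 0 0 p := .const (1 / 3)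
  have cη := cross_partials_eq hV sη η₁ η₂ hp
    ((((dA₀'.add (dA₀.mul dθ)).add (dη.mul dη)).sub (dA₁.mul dη)).add (dk.mul (dρ₁.mul dρ₁)))
    (((d23.mul dA₁').add (dη.mul dθ)).add (dk.mul (dρ₁.mul dρ₂)))
  have cθ := cross_partials_eq hV sθ θ₁ θ₂ hp
    (((d13.mul dA₁').add (dη.mul dθ)).add (dk.mul (dρ₁.mul dρ₂)))
    ((dθ.mul dθ).add (dk.mul (dρ₂.mul dρ₂)))
  rw [η₁ p hp, η₂ p hp, θ₁ p hp, θ₂ p hp, ρ₁₁ p hp, ρ₁₂ p hp] at cη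
  rw [η₂ p hp, θ₁ p hp, θ₂ p hp, ρ₁₂ p hp, ρ₂₂ p hp] at cθ
  exact ⟨by linear_combination 3 * cθ, by linear_combination cη⟩

end Lie

/-! ### Normal forms of the chain equation and of linear equations -/

theorem HasNormalForm.mono {E : ScalarODE} {A₁ A₀ : ℝ × ℝ → ℝ} {V W : Set (ℝ × ℝ)}
    (h : HasNormalForm E A₁ A₀ V) (hWV : W ⊆ V) : HasNormalForm E A₁ A₀ W :=
  fun y x hp hy => h y x (hWV hp) hy

theorem TransformsJets.mono {Φ : ℝ × ℝ → ℝ × ℝ} {V W : Set (ℝ × ℝ)} {A₁ A₀ a b : ℝ × ℝ → ℝ}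
    (h : TransformsJets Φ V A₁ A₀ a b) (hWV : W ⊆ V) : TransformsJets Φ W A₁ A₀ a b :=
  fun p hp => h p (hWV hp)

/-- The chain equation reads `y'' + (2 F + y F_y) y' + y (F² + F_x) = 0`. -/
theorem hasNormalForm_chainEq {F F₁ F₂ : ℝ × ℝ → ℝ} {V : Set (ℝ × ℝ)}
    (hF : ∀ p ∈ V, HasPartials F (F₁ p) (F₂ p) p) :
    HasNormalForm (chainEq F) (fun q => 2 * F q + q.2 * F₂ q)
      (fun q => q.2 * (F q ^ 2 + F₁ q)) V := by
  intro y x hp hy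
  have d := hy.hasDerivAt_deriv.add
    (((hF _ hp).hasDerivAt_comp (hasDerivAt_id x) hy.hasDerivAt_of_two).mul hy.hasDerivAt_of_two)
  have e : chainIter F 2 y x = deriv (deriv y) x + ((F₁ (x, y x) * 1 + F₂ (x, y x) * deriv y x)
      * y x + F (x, y x) * deriv y x) + F (x, y x) * (deriv y x + F (x, y x) * y x) := by
    have := d.deriv
    simp only [id] at this
    rw [← this]
    rfl
  unfold chainEq
  rw [e]
  constructor <;> intro h <;> linear_combination h

theorem hasNormalForm_linearEq (a b c : ℝ → ℝ) (V : Set (ℝ × ℝ)) :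
    HasNormalForm (linearEq a b c) (fun q => a q.1) (fun q => b q.1 * q.2 + c q.1) V := by
  intro w z _ _
  unfold linearEq
  rw [← add_assoc]

theorem hasNormalForm_trivialEq (V : Set (ℝ × ℝ)) :
    HasNormalForm trivialEq (fun _ => 0) (fun _ => 0) V := by
  intro w z _ _
  simp [trivialEq]

/-! ### Linearizable chain equations have affine coefficient -/

/-- For the chain equation, Lie's conditions are `4 G + y G_y = 0` and
`y (G_x + 2 F G - 2 y F_y G) = 0` with `G = F_yy`; differentiating the second one in `y` forces
`y² G² = 0`. -/
theorem partialY_partialY_eq_zero_of_linearEq {F : ℝ × ℝ → ℝ} {Φ : ℝ × ℝ → ℝ × ℝ}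
    {V : Set (ℝ × ℝ)} {a b c : ℝ → ℝ} (hF : ContDiffOn ℝ ∞ F V) (hΦ : IsPointTransformation Φ V)
    (hm : MapsEquation Φ V (chainEq F) (linearEq a b c))
    (ha : ContDiffOn ℝ ∞ a ((fun q => (Φ q).1) '' V))
    (hb : ContDiffOn ℝ ∞ b ((fun q => (Φ q).1) '' V))
    (hc : ContDiffOn ℝ ∞ c ((fun q => (Φ q).1) '' V)) {p : ℝ × ℝ} (hp : p ∈ V) :
    partialY (partialY F) p = 0 := by
  have hV := hΦ.isOpen
  have sF₁ := hF.partialX hV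
  have sF₂ := hF.partialY hV
  have sG := sF₂.partialY hV
  have s2 : ContDiffOn ℝ ∞ (fun q : ℝ × ℝ => q.2) V := contDiffOn_snd
  have nf := hasNormalForm_chainEq (fun q hq => hF.hasPartials hV hq)
  have lie := (hm.transformsJets hΦ nf (hasNormalForm_linearEq a b c _)).lie_conditions hΦ
    ((contDiffOn_const.mul hF).add (s2.mul sF₂)) (s2.mul ((hF.pow 2).add sF₁)) ha hb hc
  have dF : ∀ q ∈ V, HasPartials F (partialX F q) (partialY F q) q :=
    fun q hq => hF.hasPartials hV hq
  have conds : ∀ q ∈ V,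
      4 * partialY (partialY F) q + q.2 * partialY (partialY (partialY F)) q = 0 ∧
      q.2 * (partialX (partialY (partialY F)) q + 2 * (F q * partialY (partialY F) q)
        - 2 * (q.2 * (partialY F q * partialY (partialY F) q))) = 0 := by
    intro q hq
    obtain ⟨l₁, l₂⟩ := lie q hq
    have d2 : ∀ c : ℝ, HasPartials (fun _ => c) 0 0 q := fun c => .const c
    have dy : HasPartials (fun q => q.2) 0 1 q := .snd
    have dF₁ := hF.hasPartials_partialX hV hq
    have dF₂ := hF.hasPartials_partialY hV hq
    have dF₁₂ := sF₂.hasPartials_partialX hV hq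
    have dF₂₂ := sF₂.hasPartials_partialY hV hq
    obtain ⟨-, e₂, -, e₁₂, e₂₂⟩ := partials_eq_of_hasPartials hV
      (f := fun q => 2 * F q + q.2 * partialY F q)
      (f₁ := fun q => 2 * partialX F q + q.2 * partialX (partialY F) q)
      (f₂ := fun q => 3 * partialY F q + q.2 * partialY (partialY F) q)
      (f₁₁ := fun _ => _) (f₂₁ := fun _ => _) (f₁₂ := fun _ => _) (f₂₂ := fun _ => _)
      (fun z hz => (((HasPartials.const 2).mul (dF z hz)).add
        (HasPartials.snd.mul (hF.hasPartials_partialY hV hz))).congr_partials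
          (by ring) (by ring))
      (((d2 2).mul dF₁).add (dy.mul dF₁₂)) (((d2 3).mul dF₂).add (dy.mul dF₂₂)) hq
    obtain ⟨-, -, -, -, e₂₂'⟩ := partials_eq_of_hasPartials hV
      (f := fun q => q.2 * (F q ^ 2 + partialX F q))
      (f₁ := fun q => q.2 * (2 * (F q * partialX F q) + partialX (partialX F) q))
      (f₂ := fun q => F q * F q + partialX F q
        + q.2 * (2 * (F q * partialY F q) + partialX (partialY F) q))
      (f₁₁ := fun _ => _) (f₂₁ := fun _ => _) (f₁₂ := fun _ => _) (f₂₂ := fun _ => _)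
      (fun z hz => by
        have := HasPartials.snd.mul (((dF z hz).mul (dF z hz)).add
          (hF.hasPartials_partialX hV hz))
        simp only [pow_two]
        exact this.congr_partials (by ring) (by ring))
      (dy.mul (((d2 2).mul ((dF q hq).mul dF₁)).add (sF₁.hasPartials_partialX hV hq)))
      ((((dF q hq).mul (dF q hq)).add dF₁).add
        (dy.mul (((d2 2).mul ((dF q hq).mul dF₂)).add dF₁₂))) hq
    rw [e₂₂] at l₁
    rw [e₂₂', e₁₂, e₂] at l₂
    exact ⟨by linear_combination l₁, by linear_combination 3 * l₂⟩
  have d2 : ∀ c : ℝ, HasPartials (fun _ => c) 0 0 p := fun c => .const c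
  have dy : HasPartials (fun q => q.2) 0 1 p := .snd
  have dG := sG.hasPartials hV hp
  have dG₁ := sG.hasPartials_partialX hV hp
  have dG₂ := sG.hasPartials_partialY hV hp
  have dF₂ := hF.hasPartials_partialY hV hp
  have D₁ := (((d2 4).mul dG).add (dy.mul dG₂)).unique
    ((d2 0).congr_of_eventuallyEq
      (Filter.eventuallyEq_of_mem (hV.mem_nhds hp) fun q hq => (conds q hq).1))
  have D₂ := (dy.mul ((dG₁.add ((d2 2).mul ((dF p hp).mul dG))).sub
      ((d2 2).mul (dy.mul (dF₂.mul dG))))).unique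
    ((d2 0).congr_of_eventuallyEq
      (Filter.eventuallyEq_of_mem (hV.mem_nhds hp) fun q hq => (conds q hq).2))
  obtain ⟨c₁, c₂⟩ := conds p hp
  replace D₁ := D₁.1
  replace D₂ := D₂.2
  by_cases hy : p.2 = 0
  · rw [hy] at c₁
    linarith
  · have K := (mul_eq_zero.1 c₂).resolve_left hy
    have : (p.2 * partialY (partialY F) p) ^ 2 = 0 := by
      linear_combination (1 / 2 : ℝ) * (-D₂ + D₁ - 3 * K + (2 * F p - 2 * p.2 * partialY F p) * c₁)
    exact (mul_eq_zero.1 (pow_eq_zero_iff two_ne_zero |>.1 this)).resolve_left hy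

theorem exists_affine_of_partialY_partialY_eq_zero {F : ℝ × ℝ → ℝ} {U : Set (ℝ × ℝ)}
    (hU : IsOpen U) (hslice : ∀ x : ℝ, {y : ℝ | (x, y) ∈ U}.OrdConnected)
    (hF : ContDiffOn ℝ ∞ F U) (h : ∀ p ∈ U, partialY (partialY F) p = 0) :
    ∃ α β : ℝ → ℝ, ContDiffOn ℝ ∞ α (Prod.fst '' U) ∧ ContDiffOn ℝ ∞ β (Prod.fst '' U) ∧
      ∀ p ∈ U, F p = α p.1 * p.2 + β p.1 := by
  have dsl : ∀ {f : ℝ × ℝ → ℝ}, ContDiffOn ℝ ∞ f U → ∀ x y : ℝ, (x, y) ∈ U →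
      HasDerivAt (fun y => f (x, y)) (partialY f (x, y)) y := by
    intro f hf x y hxy
    have := (hf.hasPartials hU hxy).hasDerivAt_comp (hasDerivAt_const y x) (hasDerivAt_id y)
    simpa using this
  have const_slice : ∀ {f : ℝ → ℝ} (x : ℝ), (∀ y, (x, y) ∈ U → HasDerivAt f 0 y) →
      ∀ y z, (x, y) ∈ U → (x, z) ∈ U → f y = f z := by
    intro f x hf y z hy hz
    have ho : IsOpen {y : ℝ | (x, y) ∈ U} := hU.preimage (by fun_prop)
    exact ho.is_const_of_deriv_eq_zero (hslice x).isPreconnected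
      (fun y hy => (hf y hy).differentiableAt.differentiableWithinAt)
      (fun y hy => (hf y hy).deriv) hy hz
  have slope : ∀ x y z, (x, y) ∈ U → (x, z) ∈ U → partialY F (x, y) = partialY F (x, z) :=
    fun x => const_slice x fun y hy => by
      have := dsl (hF.partialY hU) x y hy
      rwa [h _ hy] at this
  have offset : ∀ x y z, (x, y) ∈ U → (x, z) ∈ U →
      F (x, y) - partialY F (x, y) * y = F (x, z) - partialY F (x, z) * z :=
    fun x => const_slice x fun y hy => by
      have := (dsl hF x y hy).sub ((dsl (hF.partialY hU) x y hy).mul (hasDerivAt_id y))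
      refine this.congr_deriv ?_
      rw [h _ hy]
      ring
  have hex : ∀ x ∈ Prod.fst '' U, ∃ y, (x, y) ∈ U := by
    rintro _ ⟨⟨x, y⟩, hp, rfl⟩
    exact ⟨y, hp⟩
  choose! Y hY using hex
  -- A function of `x` alone is smooth as soon as it agrees on `U` with a smooth function.
  have smooth : ∀ {f : ℝ × ℝ → ℝ}, ContDiffOn ℝ ∞ f U →
      (∀ x y z, (x, y) ∈ U → (x, z) ∈ U → f (x, y) = f (x, z)) →
      ContDiffOn ℝ ∞ (fun x => f (x, Y x)) (Prod.fst '' U) := by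
    intro f hf hind x hx
    have hp := hY x hx
    have hs : ContDiffAt ℝ ∞ (fun s => f (s, Y x)) x :=
      ContDiffAt.comp (g := f) x (hf.contDiffAt (hU.mem_nhds hp))
        (contDiffAt_id.prodMk contDiffAt_const)
    refine (hs.congr_of_eventuallyEq ?_).contDiffWithinAt
    have : ∀ᶠ s in 𝓝 x, (s, Y x) ∈ U :=
      (show Continuous fun s : ℝ => (s, Y x) by fun_prop).continuousAt.eventually
        (hU.mem_nhds hp)
    filter_upwards [this] with s hs
    exact hind s _ _ (hY s ⟨_, hs, rfl⟩) hs
  refine ⟨_, _, smooth (hF.partialY hU) slope,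
    smooth (f := fun q => F q - partialY F q * q.2)
      (hF.sub ((hF.partialY hU).mul contDiffOn_snd)) offset, ?_⟩
  rintro ⟨x, y⟩ hp
  have hx := hY x ⟨_, hp, rfl⟩
  have := offset x y _ hp hx
  dsimp only
  rw [← slope x y _ hp hx] at this ⊢
  linarith

/-! ### Antiderivatives -/

theorem contDiffOn_of_hasDerivAt {f g : ℝ → ℝ} {I : Set ℝ} (hI : IsOpen I)
    (hg : ContDiffOn ℝ ∞ g I) (h : ∀ x ∈ I, HasDerivAt f (g x) x) : ContDiffOn ℝ ∞ f I := by
  rw [contDiffOn_infty_iff_deriv_of_isOpen hI]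
  exact ⟨fun x hx => (h x hx).differentiableAt.differentiableWithinAt,
    hg.congr fun x hx => (h x hx).deriv⟩

theorem exists_antiderivative {g : ℝ → ℝ} {I : Set ℝ} (hI : IsOpen I) (hI' : I.OrdConnected)
    (hg : ContDiffOn ℝ ∞ g I) {x₀ : ℝ} (hx₀ : x₀ ∈ I) :
    ∃ f : ℝ → ℝ, f x₀ = 0 ∧ ContDiffOn ℝ ∞ f I ∧ ∀ x ∈ I, HasDerivAt f (g x) x := by
  have h : ∀ x ∈ I, HasDerivAt (fun x => ∫ t in x₀..x, g t) (g x) x := fun x hx =>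
    intervalIntegral.integral_hasDerivAt_right
      ((hg.continuousOn.mono (hI'.uIcc_subset hx₀ hx)).intervalIntegrable)
      (hg.continuousOn.stronglyMeasurableAtFilter hI x hx)
      (hg.continuousOn.continuousAt (hI.mem_nhds hx))
  exact ⟨_, by simp, contDiffOn_of_hasDerivAt hI hg h, h⟩

theorem ContDiffOn.hasDerivAt_of_isOpen {f : ℝ → ℝ} {I : Set ℝ} (hf : ContDiffOn ℝ ∞ f I)
    (hI : IsOpen I) {x : ℝ} (hx : x ∈ I) : HasDerivAt f (deriv f x) x :=
  ((hf.contDiffAt (hI.mem_nhds hx)).differentiableAt (by simp)).hasDerivAt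

/-! ### Removing the inhomogeneous part of an affine coefficient -/

/-- If `F = α(x) y + β(x)`, then `d/dx + F` is conjugated by `exp B`, `B' = β`, to
`d/dx + α(x) y`, so that `z = x`, `w = exp (B x) y` maps `Ω_F² y = 0` to a chain equation with
linear coefficient. -/
theorem exists_mapsEquation_linear_coefficient {F : ℝ × ℝ → ℝ} {U : Set (ℝ × ℝ)}
    (hU : IsOpen U) (hU' : IsPreconnected U) {α β : ℝ → ℝ}
    (hα : ContDiffOn ℝ ∞ α (Prod.fst '' U)) (hβ : ContDiffOn ℝ ∞ β (Prod.fst '' U))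
    (hF : ∀ p ∈ U, F p = α p.1 * p.2 + β p.1) :
    ∃ (Φ : ℝ × ℝ → ℝ × ℝ) (α : ℝ → ℝ), IsPointTransformation Φ U ∧ Set.InjOn Φ U ∧
      ContDiffOn ℝ ∞ α ((fun q => (Φ q).1) '' U) ∧
      MapsEquation Φ U (chainEq F) (chainEq (fun q => α q.1 * q.2)) := by
  have hI : IsOpen (Prod.fst '' U) := isOpenMap_fst _ hU
  have hI' : (Prod.fst '' U).OrdConnected := (hU'.image _ continuous_fst.continuousOn).ordConnected
  obtain ⟨B, hBs, hB⟩ : ∃ B : ℝ → ℝ, ContDiffOn ℝ ∞ B (Prod.fst '' U) ∧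
      ∀ x ∈ Prod.fst '' U, HasDerivAt B (β x) x := by
    rcases U.eq_empty_or_nonempty with rfl | ⟨p, hp⟩
    · exact ⟨0, by simp, by simp⟩
    · obtain ⟨B, -, h⟩ := exists_antiderivative hI hI' hβ (Set.mem_image_of_mem Prod.fst hp)
      exact ⟨B, h⟩
  have mem : ∀ q ∈ U, q.1 ∈ Prod.fst '' U := fun q hq => ⟨q, hq, rfl⟩
  have dB : ∀ q ∈ U, HasPartials (fun q => B q.1) (β q.1) 0 q := fun q hq =>
    (HasPartials.fst.comp (hB _ (mem q hq))).congr_partials (by ring) (by ring)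
  have dE : ∀ q ∈ U, HasPartials (fun q => Real.exp (B q.1)) (β q.1 * Real.exp (B q.1)) 0 q :=
    fun q hq => ((dB q hq).comp (Real.hasDerivAt_exp _)).congr_partials (by ring) (by ring)
  have dβ : ∀ q ∈ U, HasPartials (fun q => β q.1) (deriv β q.1) 0 q := fun q hq =>
    (HasPartials.fst.comp (hβ.hasDerivAt_of_isOpen hI (mem q hq))).congr_partials
      (by ring) (by ring)
  have dα : ∀ q ∈ U, HasPartials (fun q => α q.1) (deriv α q.1) 0 q := fun q hq =>
    (HasPartials.fst.comp (hα.hasDerivAt_of_isOpen hI (mem q hq))).congr_partials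
      (by ring) (by ring)
  obtain ⟨Φ, hΦdef⟩ : ∃ Φ : ℝ × ℝ → ℝ × ℝ, Φ = fun q => (q.1, q.2 * Real.exp (B q.1)) :=
    ⟨_, rfl⟩
  have sΦ : ContDiffOn ℝ ∞ Φ U := by
    rw [hΦdef]
    exact contDiffOn_fst.prodMk (contDiffOn_snd.mul
      (Real.contDiff_exp.comp_contDiffOn (hBs.comp contDiffOn_fst mem)))
  have pρ : ∀ p ∈ U, _ := fun p hp => partials_eq_of_hasPartials (p := p) hU
    (f := fun q => (Φ q).1) (f₁ := fun _ => 1) (f₂ := fun _ => 0)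
    (f₁₁ := fun _ => 0) (f₂₁ := fun _ => 0) (f₁₂ := fun _ => 0) (f₂₂ := fun _ => 0)
    (fun q _ => by rw [hΦdef]; exact HasPartials.fst) (.const _) (.const _) hp
  have pψ : ∀ p ∈ U, _ := fun p hp => partials_eq_of_hasPartials (p := p) hU
    (f := fun q => (Φ q).2) (f₁ := fun q => q.2 * (β q.1 * Real.exp (B q.1)))
    (f₂ := fun q => Real.exp (B q.1))
    (f₁₁ := fun q => q.2 * ((deriv β q.1 + β q.1 ^ 2) * Real.exp (B q.1)))
    (f₂₁ := fun q => β q.1 * Real.exp (B q.1))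
    (f₁₂ := fun q => β q.1 * Real.exp (B q.1)) (f₂₂ := fun _ => 0)
    (fun q hq => by
      rw [hΦdef]
      exact (HasPartials.snd.mul (dE q hq)).congr_partials (by ring) (by ring))
    ((HasPartials.snd.mul ((dβ p hp).mul (dE p hp))).congr_partials (by ring) (by ring))
    (dE p hp) hp
  have hΦ : IsPointTransformation Φ U := by
    refine ⟨hU, sΦ, fun p hp => ?_⟩
    rw [planeJacobian_eq ((sΦ.contDiffAt (hU.mem_nhds hp)).differentiableAt (by simp)),
      (pρ p hp).1, (pρ p hp).2.1, (pψ p hp).2.1]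
    simp
  have himg : (fun q => (Φ q).1) '' U = Prod.fst '' U := by rw [hΦdef]
  have nF : HasNormalForm (chainEq F) _ _ U := hasNormalForm_chainEq
    (F₁ := fun q => deriv α q.1 * q.2 + deriv β q.1) (F₂ := fun q => α q.1) fun p hp =>
    ((((dα p hp).mul .snd).add (dβ p hp)).congr_partials (by ring) (by ring)
      ).congr_of_eventuallyEq (Filter.eventuallyEq_of_mem (hU.mem_nhds hp) hF)
  have nG : HasNormalForm (chainEq fun q => α q.1 * Real.exp (-B q.1) * q.2) _ _ (Φ '' U) :=
    hasNormalForm_chainEq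
    (F₁ := fun q => (deriv α q.1 - α q.1 * β q.1) * Real.exp (-B q.1) * q.2)
    (F₂ := fun q => α q.1 * Real.exp (-B q.1)) (by
      rintro _ ⟨p, hp, rfl⟩
      have m : (Φ p).1 ∈ Prod.fst '' U := by rw [hΦdef]; exact mem p hp
      have d := (hα.hasDerivAt_of_isOpen hI m).mul (hB _ m).neg.exp
      exact ((HasPartials.fst.comp d).mul .snd).congr_partials
        (by simp only [Pi.neg_apply]; ring) (by simp))
  refine ⟨Φ, fun x => α x * Real.exp (-B x), hΦ, ?_, ?_, ?_⟩
  · rw [hΦdef]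
    rintro ⟨x, y⟩ - ⟨x', y'⟩ - h
    obtain ⟨rfl, h⟩ := Prod.mk.inj h
    exact Prod.ext rfl (mul_right_cancel₀ (Real.exp_pos _).ne' h)
  · rw [himg]
    exact hα.mul (Real.contDiff_exp.comp_contDiffOn hBs.neg)
  · refine TransformsJets.mapsEquation hΦ ?_ nF nG
    intro p hp u v u₂ v₂
    obtain ⟨r₁, r₂, r₁₁, r₁₂, r₂₂⟩ := pρ p hp
    obtain ⟨s₁, s₂, s₁₁, s₁₂, s₂₂⟩ := pψ p hp
    rw [planeJacobian_eq (hΦ.differentiableAt hp)]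
    simp only [curveDeriv, curveDeriv₂, r₁, r₂, r₁₁, r₁₂, r₂₂, s₁, s₂, s₁₁, s₁₂, s₂₂, hF p hp]
    simp only [hΦdef]
    have he : Real.exp (B p.1) * Real.exp (-B p.1) = 1 := by
      rw [← Real.exp_add, add_neg_cancel, Real.exp_zero]
    generalize Real.exp (B p.1) = e at *
    generalize Real.exp (-B p.1) = e' at *
    generalize α p.1 = a at *
    generalize β p.1 = b at *
    have h2 : e ^ 2 * e' = e := by linear_combination e * he
    have h3 : e ^ 3 * e' ^ 2 = e := by linear_combination (e ^ 2 * e' + e) * he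
    linear_combination (3 * a * p.2 * (p.2 * b * u + v) * u ^ 2
      + p.2 ^ 2 * (deriv α p.1 - a * b) * u ^ 3) * h2 + a ^ 2 * p.2 ^ 3 * u ^ 3 * h3

/-! ### Explicit transformations to the trivial equation -/

/-- A criterion for `(ρ, ψ)` to map `y'' + A₁ y' + A₀ = 0` to `w'' = 0`, when `dψ = L dρ + M dx`
with `L` a function of `x` only. In this situation the slope of the image of a curve is
`L + M x' / ρ'`, and second derivatives of `ψ` do not have to be computed. -/
theorem transformsJets_of_slope {ρ ψ ρ₁ ρ₂ ρ₁₁ ρ₁₂ ρ₂₂ M M₁ M₂ A₁ A₀ : ℝ × ℝ → ℝ} {L l : ℝ → ℝ}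
    {V : Set (ℝ × ℝ)} (hV : IsOpen V) (sρ : ContDiffOn ℝ ∞ ρ V) (sψ : ContDiffOn ℝ ∞ ψ V)
    (dρ : ∀ p ∈ V, HasPartials ρ (ρ₁ p) (ρ₂ p) p)
    (dρ₁ : ∀ p ∈ V, HasPartials ρ₁ (ρ₁₁ p) (ρ₁₂ p) p)
    (dρ₂ : ∀ p ∈ V, HasPartials ρ₂ (ρ₁₂ p) (ρ₂₂ p) p)
    (dL : ∀ p ∈ V, HasDerivAt L (l p.1) p.1)
    (dM : ∀ p ∈ V, HasPartials M (M₁ p) (M₂ p) p)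
    (dψ : ∀ p ∈ V, HasPartials ψ (L p.1 * ρ₁ p + M p) (L p.1 * ρ₂ p) p)
    (h0 : ∀ p ∈ V, ρ₂ p * M p ≠ 0)
    (hM₂ : ∀ p ∈ V, M₂ p = l p.1 * ρ₂ p)
    (c₀ : ∀ p ∈ V, (l p.1 * ρ₁ p + M₁ p) * ρ₁ p - M p * ρ₁₁ p = -(ρ₂ p * M p) * A₀ p)
    (c₁ : ∀ p ∈ V, (l p.1 * ρ₁ p + M₁ p) * ρ₂ p + 2 * M₂ p * ρ₁ p - 2 * M p * ρ₁₂ p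
      = -(ρ₂ p * M p) * A₁ p)
    (c₂ : ∀ p ∈ V, 2 * M₂ p * ρ₂ p - M p * ρ₂₂ p = 0) :
    IsPointTransformation (fun p => (ρ p, ψ p)) V ∧
      TransformsJets (fun p => (ρ p, ψ p)) V A₁ A₀ (fun _ => 0) (fun _ => 0) := by
  have sΦ : ContDiffOn ℝ ∞ (fun p => (ρ p, ψ p)) V := sρ.prodMk sψ
  have jac : ∀ p ∈ V, planeJacobian (fun p => (ρ p, ψ p)) p = -(ρ₂ p * M p) := by
    intro p hp
    rw [planeJacobian_eq ((sΦ.contDiffAt (hV.mem_nhds hp)).differentiableAt (by simp))]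
    simp only [(dρ p hp).partialX_eq, (dρ p hp).partialY_eq, (dψ p hp).partialX_eq,
      (dψ p hp).partialY_eq]
    ring
  refine ⟨⟨hV, sΦ, fun p hp => ?_⟩, fun p hp u v u₂ v₂ => ?_⟩
  · rw [jac p hp]
    exact neg_ne_zero.2 (h0 p hp)
  · have dLp : HasPartials (fun q => L q.1) (l p.1) 0 p :=
      (HasPartials.fst.comp (dL p hp)).congr_partials (by ring) (by ring)
    obtain ⟨r₁, r₂, r₁₁, r₁₂, r₂₂⟩ := partials_eq_of_hasPartials hV (f₁₁ := fun _ => _)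
      (f₁₂ := fun _ => _) (f₂₁ := fun _ => _) (f₂₂ := fun _ => _) dρ (dρ₁ p hp) (dρ₂ p hp) hp
    obtain ⟨s₁, s₂, s₁₁, s₁₂, s₂₂⟩ := partials_eq_of_hasPartials hV (f₁₁ := fun _ => _)
      (f₁₂ := fun _ => _) (f₂₁ := fun _ => _) (f₂₂ := fun _ => _)
      (f₁ := fun q => L q.1 * ρ₁ q + M q) (f₂ := fun q => L q.1 * ρ₂ q) dψ
      ((dLp.mul (dρ₁ p hp)).add (dM p hp)) (dLp.mul (dρ₂ p hp)) hp
    rw [jac p hp]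
    simp only [curveDeriv, curveDeriv₂, r₁, r₂, r₁₁, r₁₂, r₂₂, s₁, s₂, s₁₁, s₁₂, s₂₂]
    linear_combination u ^ 3 * c₀ p hp + u ^ 2 * v * c₁ p hp + u * v ^ 2 * c₂ p hp
      - 2 * u * v * (ρ₁ p * u + ρ₂ p * v) * hM₂ p hp

/-- The normal form of the chain equation with `F = α(x) y`. -/
theorem hasNormalForm_chainEq_linear {α : ℝ → ℝ} {I : Set ℝ} (hI : IsOpen I)
    (hα : ContDiffOn ℝ ∞ α I) {V : Set (ℝ × ℝ)} (hV : ∀ p ∈ V, p.1 ∈ I) :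
    HasNormalForm (chainEq fun q => α q.1 * q.2) (fun q => 3 * α q.1 * q.2)
      (fun q => q.2 ^ 2 * (α q.1 ^ 2 * q.2 + deriv α q.1)) V := by
  have h := hasNormalForm_chainEq (F := fun q => α q.1 * q.2) (V := V)
    (F₁ := fun q => deriv α q.1 * q.2) (F₂ := fun q => α q.1) fun p hp =>
      ((HasPartials.fst.comp (hα.hasDerivAt_of_isOpen hI (hV p hp))).mul .snd).congr_partials
        (by ring) (by ring)
  intro y x hp hy
  rw [h y x hp hy]
  constructor <;> intro h <;> linear_combination h

/-- Around every point `(z₀, w₀)` the chain equation with `G = α(z) w` is mapped to `W'' = 0`.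
With antiderivatives `A' = α`, `B' = z α` its solutions are the curves
`c₁ w + c₂ (w A - 1) + c₃ (w B - z) = 0`, hence straight lines in the coordinates
`w / (w A - 1)`, `(w B - z) / (w A - 1)`, which are defined near `(z₀, w₀)` if `A z₀ = 0`. -/
theorem exists_transformsJets_trivial {α : ℝ → ℝ} {I : Set ℝ} (hI : IsOpen I)
    (hα : ContDiffOn ℝ ∞ α I) {p : ℝ × ℝ} (hp : p.1 ∈ I) :
    ∃ (W : Set (ℝ × ℝ)) (Ψ : ℝ × ℝ → ℝ × ℝ), p ∈ W ∧ IsPointTransformation Ψ W ∧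
      TransformsJets Ψ W (fun q => 3 * α q.1 * q.2)
        (fun q => q.2 ^ 2 * (α q.1 ^ 2 * q.2 + deriv α q.1)) (fun _ => 0) (fun _ => 0) := by
  obtain ⟨ε, hε, hball⟩ := Metric.isOpen_iff.1 hI p.1 hp
  have hb := Metric.mem_ball_self (x := p.1) hε
  have hα' := hα.mono hball
  have hoc : (Metric.ball p.1 ε).OrdConnected := (convex_ball p.1 ε).ordConnected
  obtain ⟨A, hA0, hAs, hA⟩ := exists_antiderivative Metric.isOpen_ball hoc hα' hb
  obtain ⟨B, -, hBs, hB⟩ := exists_antiderivative (g := fun z => z * α z) Metric.isOpen_ball hoc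
    (contDiffOn_id.mul hα') hb
  obtain ⟨W, hW⟩ : ∃ W : Set (ℝ × ℝ),
      W = {q | q.1 ∈ Metric.ball p.1 ε} ∩ (fun q => q.2 * A q.1 - 1) ⁻¹' {0}ᶜ := ⟨_, rfl⟩
  have h1 : ∀ q ∈ W, q.1 ∈ Metric.ball p.1 ε := by rw [hW]; exact fun q hq => hq.1
  have h2 : ∀ q ∈ W, q.2 * A q.1 - 1 ≠ 0 := by rw [hW]; exact fun q hq => hq.2
  have sA' : ContDiffOn ℝ ∞ (fun q : ℝ × ℝ => q.2 * A q.1 - 1) {q | q.1 ∈ Metric.ball p.1 ε} :=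
    (contDiffOn_snd.mul (hAs.comp contDiffOn_fst fun q hq => hq)).sub contDiffOn_const
  have hWo : IsOpen W := by
    rw [hW]
    exact sA'.continuousOn.isOpen_inter_preimage (Metric.isOpen_ball.preimage continuous_fst)
      isOpen_compl_singleton
  have hpW : p ∈ W := by
    rw [hW]
    refine ⟨hb, ?_⟩
    simp [hA0]
  have sA : ContDiffOn ℝ ∞ (fun q : ℝ × ℝ => (q.2 * A q.1 - 1)⁻¹) W :=
    (sA'.mono h1).inv h2
  have sB : ContDiffOn ℝ ∞ (fun q : ℝ × ℝ => B q.1) W := hBs.comp contDiffOn_fst h1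
  -- `i` is the reciprocal of the common denominator.
  obtain ⟨i, hi⟩ : ∃ i : ℝ × ℝ → ℝ, i = fun q => (q.2 * A q.1 - 1)⁻¹ := ⟨_, rfl⟩
  have ii : ∀ q ∈ W, (q.2 * A q.1 - 1) * i q = 1 := by
    intro q hq; rw [hi]; exact mul_inv_cancel₀ (h2 q hq)
  rw [← hi] at sA
  have dA : ∀ q ∈ W, HasPartials (fun q => A q.1) (α q.1) 0 q := fun q hq =>
    (HasPartials.fst.comp (hA _ (h1 q hq))).congr_partials (by ring) (by ring)
  have dB : ∀ q ∈ W, HasPartials (fun q => B q.1) (q.1 * α q.1) 0 q := fun q hq =>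
    (HasPartials.fst.comp (hB _ (h1 q hq))).congr_partials (by ring) (by ring)
  have dα : ∀ q ∈ W, HasPartials (fun q => α q.1) (deriv α q.1) 0 q := fun q hq =>
    (HasPartials.fst.comp (hα.hasDerivAt_of_isOpen hI (hball (h1 q hq)))).congr_partials
      (by ring) (by ring)
  have di : ∀ q ∈ W, HasPartials i (-(q.2 * α q.1 * i q ^ 2)) (-(A q.1 * i q ^ 2)) q := by
    intro q hq
    have := ((HasPartials.snd.mul (dA q hq)).sub (.const 1)).inv (h2 q hq)
    rw [hi]
    exact this.congr_partials (by field_simp; ring) (by field_simp; ring)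
  obtain ⟨hΨ, hj⟩ := transformsJets_of_slope (V := W) (A₁ := fun q => 3 * α q.1 * q.2)
    (A₀ := fun q => q.2 ^ 2 * (α q.1 ^ 2 * q.2 + deriv α q.1))
    (ρ := fun q => q.2 * i q) (ψ := fun q => (q.2 * B q.1 - q.1) * i q)
    (ρ₁ := fun q => -(q.2 * q.2 * α q.1 * (i q * i q))) (ρ₂ := fun q => -(i q * i q))
    (ρ₁₁ := fun q => -(q.2 ^ 2 * deriv α q.1 * i q ^ 2) + 2 * q.2 ^ 3 * α q.1 ^ 2 * i q ^ 3)
    (ρ₁₂ := fun q => 2 * q.2 * α q.1 * i q ^ 3) (ρ₂₂ := fun q => 2 * A q.1 * i q ^ 3)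
    (L := fun z => B z - z * A z) (l := fun z => -A z) (M := fun q => 0 - i q)
    (M₁ := fun q => q.2 * α q.1 * i q ^ 2) (M₂ := fun q => A q.1 * i q ^ 2) hWo
    (contDiffOn_snd.mul sA) (((contDiffOn_snd.mul sB).sub contDiffOn_fst).mul sA)
    (fun q hq => (HasPartials.snd.mul (di q hq)).congr_partials (by ring)
      (by linear_combination -i q * ii q hq))
    (fun q hq => ((HasPartials.const 0).sub (((HasPartials.snd.mul .snd).mul (dα q hq)).mul
      ((di q hq).mul (di q hq))) |>.congr_of_eventuallyEq (.of_eq (by ext; simp))).congr_partials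
        (by ring) (by linear_combination 2 * q.2 * α q.1 * i q ^ 2 * ii q hq))
    (fun q hq => ((HasPartials.const 0).sub ((di q hq).mul (di q hq))
      |>.congr_of_eventuallyEq (.of_eq (by ext; simp))).congr_partials (by ring) (by ring))
    (fun q hq => ((hB _ (h1 q hq)).sub ((hasDerivAt_id _).mul (hA _ (h1 q hq)))).congr_deriv
      (by simp))
    (fun q hq => ((HasPartials.const 0).sub (di q hq)).congr_partials (by ring) (by ring))
    (fun q hq => (((HasPartials.snd.mul (dB q hq)).sub .fst).mul (di q hq)).congr_partials
      (by linear_combination (-i q * q.1 * q.2 * α q.1) * ii q hq)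
      (by linear_combination (-i q * B q.1) * ii q hq))
    (fun q hq => by
      have : i q ≠ 0 := right_ne_zero_of_mul_eq_one (ii q hq)
      simp [this])
    (fun q hq => by ring)
    (fun q hq => by
      linear_combination (-q.2 ^ 3 * α q.1 ^ 2 * i q ^ 3) * ii q hq)
    (fun q hq => by
      linear_combination (-3 * q.2 * α q.1 * i q ^ 3) * ii q hq)
    (fun q hq => by ring)
  exact ⟨W, _, hpW, hΨ, hj⟩

/-- The family `(rhoFam, psiFam)`: here `ψ = L ρ + J + k₂` with
`L(x) = k₄ + k₆ (x - 1) / ((k₅ - 1) (k₅ - x))`. -/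
theorem rhoFam_psiFam_transforms {S : Set ℝ} {α T J : ℝ → ℝ} {k₁ k₂ k₃ k₄ k₅ k₆ : ℝ}
    (hS : IsOpen S) (h5 : k₅ ∉ S) (hα : ContDiffOn ℝ ∞ α S) (h36 : k₃ * k₆ ≠ 0) (h51 : k₅ ≠ 1)
    (hT : ∀ x ∈ S, HasDerivAt T ((k₅ - x) * α x / k₃) x)
    (hJ : ∀ x ∈ S, HasDerivAt J (k₆ * (k₁ - T x) / (k₅ - x) ^ 2) x) :
    IsPointTransformation
        (fun p => (rhoFam k₁ k₃ k₅ T p.1 p.2, psiFam k₁ k₂ k₃ k₄ k₅ k₆ T J p.1 p.2))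
        {p : ℝ × ℝ | p.1 ∈ S ∧ p.2 ≠ 0} ∧
      TransformsJets
        (fun p => (rhoFam k₁ k₃ k₅ T p.1 p.2, psiFam k₁ k₂ k₃ k₄ k₅ k₆ T J p.1 p.2))
        {p : ℝ × ℝ | p.1 ∈ S ∧ p.2 ≠ 0} (fun q => 3 * α q.1 * q.2)
        (fun q => q.2 ^ 2 * (α q.1 ^ 2 * q.2 + deriv α q.1)) (fun _ => 0) (fun _ => 0) := by
  have h3 : k₃ ≠ 0 := left_ne_zero_of_mul h36
  have h6 : k₆ ≠ 0 := right_ne_zero_of_mul h36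
  have h51' : k₅ - 1 ≠ 0 := sub_ne_zero.2 h51
  obtain ⟨V, hV⟩ : ∃ V : Set (ℝ × ℝ), V = {p : ℝ × ℝ | p.1 ∈ S ∧ p.2 ≠ 0} := ⟨_, rfl⟩
  rw [← hV]
  have hm : ∀ p ∈ V, p.1 ∈ S := by rw [hV]; exact fun p hp => hp.1
  have hy : ∀ p ∈ V, p.2 ≠ 0 := by rw [hV]; exact fun p hp => hp.2
  have hx : ∀ x ∈ S, k₅ - x ≠ 0 := fun x hx h => h5 (by rwa [sub_eq_zero.1 h])
  have hx' : ∀ p ∈ V, k₅ - p.1 ≠ 0 := fun p hp => hx _ (hm p hp)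
  have hVo : IsOpen V := by
    rw [hV]
    exact (hS.preimage continuous_fst).inter (isOpen_ne.preimage continuous_snd)
  have sT : ContDiffOn ℝ ∞ T S := contDiffOn_of_hasDerivAt hS
    (((contDiffOn_const.sub contDiffOn_id).mul hα).div_const k₃) hT
  have sJ : ContDiffOn ℝ ∞ J S := contDiffOn_of_hasDerivAt hS
    ((contDiffOn_const.mul (contDiffOn_const.sub sT)).div
      ((contDiffOn_const.sub contDiffOn_id).pow 2) fun x h => pow_ne_zero 2 (hx x h)) hJ
  have sTV : ContDiffOn ℝ ∞ (fun q : ℝ × ℝ => T q.1) V := sT.comp contDiffOn_fst hm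
  have sJV : ContDiffOn ℝ ∞ (fun q : ℝ × ℝ => J q.1) V := sJ.comp contDiffOn_fst hm
  have sρ : ContDiffOn ℝ ∞ (fun q : ℝ × ℝ => rhoFam k₁ k₃ k₅ T q.1 q.2) V := by
    unfold rhoFam
    exact (((contDiffOn_fst.sub contDiffOn_const).div (contDiffOn_const.mul contDiffOn_snd)
      fun q hq => mul_ne_zero h3 (hy q hq)).sub contDiffOn_const).add sTV
  obtain ⟨L, hL⟩ : ∃ L : ℝ → ℝ, L = fun x => k₄ + k₆ * (x - 1) / ((k₅ - 1) * (k₅ - x)) :=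
    ⟨_, rfl⟩
  have dL : ∀ x ∈ S, HasDerivAt L (k₆ / (k₅ - x) ^ 2) x := by
    intro x h
    have h0 := hx x h
    have := ((((hasDerivAt_id x).sub_const 1).const_mul k₆).div
      (((hasDerivAt_id x).const_sub k₅).const_mul (k₅ - 1)) (mul_ne_zero h51' h0)).const_add k₄
    rw [hL]
    refine this.congr_deriv ?_
    simp only [id]
    field_simp
    ring
  have sL : ContDiffOn ℝ ∞ L S := contDiffOn_of_hasDerivAt hS
    (contDiffOn_const.div ((contDiffOn_const.sub contDiffOn_id).pow 2)
      fun x h => pow_ne_zero 2 (hx x h)) dL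
  have hψ : ∀ q ∈ V, psiFam k₁ k₂ k₃ k₄ k₅ k₆ T J q.1 q.2
      = L q.1 * rhoFam k₁ k₃ k₅ T q.1 q.2 + (J q.1 + k₂) := by
    intro q hq
    have := hy q hq
    have := hx' q hq
    rw [hL]
    unfold psiFam rhoFam
    field_simp
    ring
  have sψ : ContDiffOn ℝ ∞ (fun q : ℝ × ℝ => psiFam k₁ k₂ k₃ k₄ k₅ k₆ T J q.1 q.2) V :=
    (((sL.comp contDiffOn_fst hm).mul sρ).add (sJV.add contDiffOn_const)).congr hψ
  have dα : ∀ q ∈ V, HasPartials (fun q => α q.1) (deriv α q.1) 0 q := fun q hq =>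
    (HasPartials.fst.comp (hα.hasDerivAt_of_isOpen hS (hm q hq))).congr_partials
      (by ring) (by ring)
  have diy : ∀ q ∈ V, HasPartials (fun q => q.2⁻¹) 0 (-(q.2⁻¹) ^ 2) q := fun q hq =>
    (HasPartials.snd.inv (hy q hq)).congr_partials (by simp) (by ring)
  have dxk : ∀ q : ℝ × ℝ, HasPartials (fun q => q.1 - k₅) 1 0 q := fun q =>
    (HasPartials.fst.sub (.const k₅)).congr_partials (by ring) (by ring)
  have dix : ∀ q ∈ V, HasPartials (fun q => (q.1 - k₅)⁻¹) (-((q.1 - k₅)⁻¹) ^ 2) 0 q :=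
    fun q hq => ((dxk q).inv (by rw [← neg_sub]; exact neg_ne_zero.2 (hx' q hq))).congr_partials
      (by rw [inv_pow, neg_div, one_div]) (by simp)
  have dρ : ∀ q ∈ V, HasPartials (fun q => rhoFam k₁ k₃ k₅ T q.1 q.2)
      (k₃⁻¹ * (q.2⁻¹ - (q.1 - k₅) * α q.1)) (-k₃⁻¹ * ((q.1 - k₅) * (q.2⁻¹ * q.2⁻¹))) q := by
    intro q hq
    have := (((HasPartials.const k₃⁻¹).mul ((dxk q).mul (diy q hq))).sub (.const k₁)).add
      (HasPartials.fst.comp (hT _ (hm q hq)))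
    refine (this.congr_of_eventuallyEq (.of_eq ?_)).congr_partials (by ring) (by ring)
    ext z
    unfold rhoFam
    ring
  refine transformsJets_of_slope (l := fun x => k₆ / (k₅ - x) ^ 2)
    (ρ₁₁ := fun q => -k₃⁻¹ * (α q.1 + (q.1 - k₅) * deriv α q.1))
    (ρ₁₂ := fun q => -k₃⁻¹ * (q.2⁻¹) ^ 2)
    (ρ₂₂ := fun q => 2 * k₃⁻¹ * (q.1 - k₅) * (q.2⁻¹) ^ 3)
    (M := fun q => k₆ * k₃⁻¹ * ((q.1 - k₅)⁻¹ * q.2⁻¹))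
    (M₁ := fun q => -(k₆ * k₃⁻¹ * (((q.1 - k₅)⁻¹) ^ 2 * q.2⁻¹)))
    (M₂ := fun q => -(k₆ * k₃⁻¹ * ((q.1 - k₅)⁻¹ * (q.2⁻¹) ^ 2)))
    hVo sρ sψ dρ
    (fun q hq => ((HasPartials.const k₃⁻¹).mul ((diy q hq).sub
      ((dxk q).mul (dα q hq)))).congr_partials (by ring) (by ring))
    (fun q hq => ((HasPartials.const (-k₃⁻¹)).mul ((dxk q).mul
      ((diy q hq).mul (diy q hq)))).congr_partials (by ring) (by ring))
    (fun q hq => dL _ (hm q hq))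
    (fun q hq => ((HasPartials.const (k₆ * k₃⁻¹)).mul ((dix q hq).mul
      (diy q hq))).congr_partials (by ring) (by ring))
    (fun q hq => ?_) ?_ ?_ ?_ ?_ (fun q _ => by ring)
  · have h₁ := hy q hq
    have h₂ := hx' q hq
    have h₃ : q.1 - k₅ ≠ 0 := by rw [← neg_sub]; exact neg_ne_zero.2 h₂
    have := ((HasPartials.fst.comp (dL _ (hm q hq))).mul (dρ q hq)).add
      ((HasPartials.fst.comp (hJ _ (hm q hq))).add (.const k₂))
    refine (this.congr_of_eventuallyEq
      (Filter.eventuallyEq_of_mem (hVo.mem_nhds hq) hψ)).congr_partials ?_ (by ring)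
    unfold rhoFam
    rw [← neg_sub q.1 k₅]
    field_simp
    ring
  all_goals
    intro q hq
    have h₁ := hy q hq
    have h₃ : q.1 - k₅ ≠ 0 := by rw [← neg_sub]; exact neg_ne_zero.2 (hx' q hq)
  · simp [h₁, h₃, h3, h6]
  all_goals
    rw [← neg_sub q.1 k₅]
    field_simp
  all_goals ring

theorem trivialEq_eq_linearEq : trivialEq = linearEq 0 0 0 := by
  funext w z
  simp [trivialEq, linearEq]

theorem theorem1 :
    (∀ (U : Set (ℝ × ℝ)) (F : ℝ × ℝ → ℝ), IsOpen U → IsPreconnected U →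
      (∀ x : ℝ, {y : ℝ | (x, y) ∈ U}.OrdConnected) → ContDiffOn ℝ ∞ F U →
      List.TFAE
        [ Linearizable U (chainEq F),
          Trivializable U (chainEq F),
          ∃ α β : ℝ → ℝ, ContDiffOn ℝ ∞ α (Prod.fst '' U) ∧ ContDiffOn ℝ ∞ β (Prod.fst '' U) ∧
            ∀ p ∈ U, F p = α p.1 * p.2 + β p.1,
          ∃ (Φ : ℝ × ℝ → ℝ × ℝ) (α : ℝ → ℝ), IsPointTransformation Φ U ∧ Set.InjOn Φ U ∧
            ContDiffOn ℝ ∞ α ((fun q => (Φ q).1) '' U) ∧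
            MapsEquation Φ U (chainEq F) (chainEq (fun q => α q.1 * q.2)) ]) ∧
    (∀ (S : Set ℝ) (α T J : ℝ → ℝ) (k₁ k₂ k₃ k₄ k₅ k₆ : ℝ),
      IsOpen S → k₅ ∉ S → ContDiffOn ℝ ∞ α S → k₃ * k₆ ≠ 0 → k₅ ≠ 1 →
      (∀ x ∈ S, HasDerivAt T ((k₅ - x) * α x / k₃) x) →
      (∀ x ∈ S, HasDerivAt J (k₆ * (k₁ - T x) / (k₅ - x) ^ 2) x) →
      IsPointTransformation
          (fun p => (rhoFam k₁ k₃ k₅ T p.1 p.2, psiFam k₁ k₂ k₃ k₄ k₅ k₆ T J p.1 p.2))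
          {p : ℝ × ℝ | p.1 ∈ S ∧ p.2 ≠ 0} ∧
        MapsEquation
          (fun p => (rhoFam k₁ k₃ k₅ T p.1 p.2, psiFam k₁ k₂ k₃ k₄ k₅ k₆ T J p.1 p.2))
          {p : ℝ × ℝ | p.1 ∈ S ∧ p.2 ≠ 0}
          (chainEq (fun p => α p.1 * p.2)) trivialEq) := by
  refine ⟨fun U F hU hU' hslice hF => ?_, ?_⟩
  · have nF := hasNormalForm_chainEq fun q hq => hF.hasPartials hU (p := q) hq
    tfae_have 2 → 1 := by
      intro h p hp
      obtain ⟨V, Φ, hpV, hVU, hΦ, hinj, hm⟩ := h p hp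
      exact ⟨V, Φ, 0, 0, 0, hpV, hVU, hΦ, hinj, contDiffOn_const, contDiffOn_const,
        contDiffOn_const, trivialEq_eq_linearEq ▸ hm⟩
    tfae_have 1 → 3 := by
      intro h
      refine exists_affine_of_partialY_partialY_eq_zero hU hslice hF fun p hp => ?_
      obtain ⟨V, Φ, a, b, c, hpV, hVU, hΦ, -, ha, hb, hc, hm⟩ := h p hp
      exact partialY_partialY_eq_zero_of_linearEq (hF.mono hVU) hΦ hm ha hb hc hpV
    tfae_have 3 → 4 := by
      rintro ⟨α, β, hα, hβ, h⟩
      exact exists_mapsEquation_linear_coefficient hU hU' hα hβ h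
    tfae_have 4 → 2 := by
      rintro ⟨Φ, α, hΦ, -, hα, hm⟩ p hp
      have hI := hΦ.isOpen_image_fst
      have hj := hm.transformsJets hΦ nF (hasNormalForm_chainEq_linear hI hα (by
        rintro _ ⟨q, hq, rfl⟩
        exact ⟨q, hq, rfl⟩))
      obtain ⟨W, Ψ, hpW, hΨ, hj'⟩ := exists_transformsJets_trivial hI hα (p := Φ p) ⟨p, hp, rfl⟩
      have hVo : IsOpen (U ∩ Φ ⁻¹' W) :=
        hΦ.smooth.continuousOn.isOpen_inter_preimage hU hΨ.isOpen
      obtain ⟨V, hV, hpV, hVsub, hinj⟩ := (hΨ.comp (hΦ.mono hVo Set.inter_subset_left)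
        fun q hq => hq.2).exists_injOn (p := p) ⟨hp, hpW⟩
      have hVU : V ⊆ U := fun q hq => (hVsub hq).1
      have hVW : Set.MapsTo Φ V W := fun q hq => (hVsub hq).2
      have hΦV := hΦ.mono hV hVU
      exact ⟨V, Ψ ∘ Φ, hpV, hVU, hΨ.comp hΦV hVW, hinj,
        (hj.mono hVU).mapsEquation_comp hΦV hΨ hj' hVW (nF.mono hVU)
          (hasNormalForm_trivialEq _)⟩
    tfae_finish
  · intro S α T J k₁ k₂ k₃ k₄ k₅ k₆ hS h5 hα h36 h51 hT hJ
    obtain ⟨hΦ, hj⟩ := rhoFam_psiFam_transforms (k₂ := k₂) (k₄ := k₄) hS h5 hα h36 h51 hT hJ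
    exact ⟨hΦ, hj.mapsEquation hΦ (hasNormalForm_chainEq_linear hS hα fun p hp => hp.1)
      (hasNormalForm_trivialEq _)⟩
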